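/- A \emph{curve} in $\mathbb{R}^d$ is a continuous map $\gamma\colon I\to\mathbb{R}^d$, where $I=[a,b]\subset\mathbb{R}$, $a\le b$, is a compact interval. For an integer $k\ge 0$, the curve $\gamma$ is called \emph{$k$-crossing} if $|\{t\in I:\gamma(t)\in h\}|\le k$ for every (affine) hyperplane $h\subset\mathbb{R}^d$; that is, $\gamma$ meets every hyperplane at most $k$ times, where intersections are counted by parameter values. A $d$-crossing curve in $\mathbb{R}^d$ is called \emph{convex}. \textbf{Theorem.} For every integer $d\ge 2$ there exists an integer $M=M(d)$ such that every $(d+1)$-crossing curve $\gamma\colon[a,b]\to\mathbb{R}^d$ can be subdivided into at most $M$ convex curves: there are an integer $k$ with $1\le k\le M$ and points $a=c_0\le c_1\le\dots\le c_k=b$ such that, for each $i=1,\dots,k$, the restriction of $\gamma$ to the closed interval $[c_{i-1},c_i]$ is convex. -/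

import Mathlib

/-- `H` is an (affine) hyperplane of `ℝ^d`: the solution set of one linear equation
`⟪u, x⟫ = c` with a nonzero normal vector `u`. -/
def IsHyperplane {d : ℕ} (H : Set (EuclideanSpace ℝ (Fin d))) : Prop :=
  ∃ (u : EuclideanSpace ℝ (Fin d)) (c : ℝ), u ≠ 0 ∧ H = {x | inner ℝ u x = c}

/-- `γ` is a curve in `ℝ^d` with parameter interval `[a, b]`. Only the values of `γ` on `[a, b]`
matter. -/
structure IsCurveOn {d : ℕ} (γ : ℝ → EuclideanSpace ℝ (Fin d)) (a b : ℝ) : Prop where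
  le : a ≤ b
  continuousOn : ContinuousOn γ (Set.Icc a b)

/-- The restriction of `γ` to `[a, b]` is a curve that meets every hyperplane at most `k` times,
where intersections are counted by parameter values. -/
structure IsCrossingOn {d : ℕ} (k : ℕ) (γ : ℝ → EuclideanSpace ℝ (Fin d)) (a b : ℝ) : Prop
    extends IsCurveOn γ a b where
  encard_le : ∀ H : Set (EuclideanSpace ℝ (Fin d)), IsHyperplane H →
    {t : ℝ | t ∈ Set.Icc a b ∧ γ t ∈ H}.encard ≤ (k : ℕ∞)

/-- The restriction of `γ : ℝ → ℝ^d` to `[a, b]` is a convex curve: it meets every hyperplane at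
most `d` times. -/
def IsConvexCurveOn {d : ℕ} (γ : ℝ → EuclideanSpace ℝ (Fin d)) (a b : ℝ) : Prop :=
  IsCrossingOn d γ a b

/-!
The affine functions restricted to a `(d + 1)`-crossing curve form a space `W` of dimension `d + 1`
whose nonzero elements have at most `d + 1` zeros, and a piece of the curve is convex exactly if
they have at most `d` zeros there, that is, if `W` is a Chebyshev space on that piece. The heart of
the proof is `exists_forall_not_isBlockSequence`: there is a bound, depending on the dimension only,
for the number of disjoint intervals ("blocks") each of which contains `d + 1` zeros of some nonzero
function of `W`. No positive function is needed, so the bound can be proved by induction on the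
dimension.

Fix a point `a` in the first block and pass to the subspace of functions vanishing at `a`. By
induction, if there are many blocks, then some long run of consecutive blocks has a hull `J` on which
this subspace is Chebyshev. Let `D (t₀, …, t_d)` be the determinant of the values of a basis of `W`
at increasing points of `J`. The Chebyshev property of the subspace makes the zeros of `D`
transversal and coherently oriented: at a zero, either `D` increases in every variable, or `D`
decreases in every variable (`isTransversal_det_collocationMatrix`). Hence the two monotone paths
around a rectangle meet the same number of sign changes of `D`, and the number of sign changes along
a monotone path depends on its ends only. The path that moves the points one after the other meets
at most `d + 1` sign changes, as each point meets at most one. On the other hand every block contains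
configurations of both signs, and a monotone path through all blocks meets as many sign changes as
desired. So the run of blocks is short (`IsTransversal.length_le`).

With a bound for blocks, greedy cutting yields boundedly many open intervals on which `W` is
Chebyshev. Halving each of them gives closed intervals with the same property, because a function
with `d + 1` zeros, one of them at an end point of the open interval, could be perturbed to have
`d + 1` zeros in its interior (`HasAtMostZeros.Icc_left`).
-/

/-! ### Counting sign changes along monotone paths of configurations -/

/-- If every zero of `φ` on `[u, w]` is a sign change with a definite sign on each whole side (the
sign of `e * (s - z)` at `s`), then equal weak signs at the two ends force the same weak sign in
between. Zeros at the ends or at `v` are allowed: `0 ≤ φ` counts a zero as positive. -/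
theorem weakSign_of_endpoints {φ : ℝ → ℝ} {u v w : ℝ} (huv : u ≤ v) (hvw : v ≤ w)
    (hφ : ContinuousOn φ (Set.Icc u w))
    (hz : ∀ z ∈ Set.Icc u w, φ z = 0 →
      ∃ e : ℝ, ∀ s ∈ Set.Icc u w, s ≠ z → 0 < e * (s - z) * φ s)
    (h : 0 ≤ φ u ↔ 0 ≤ φ w) : 0 ≤ φ v ↔ 0 ≤ φ u := by
  have hu : u ∈ Set.Icc u w := ⟨le_rfl, huv.trans hvw⟩
  have hv : v ∈ Set.Icc u w := ⟨huv, hvw⟩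
  have hw : w ∈ Set.Icc u w := ⟨huv.trans hvw, le_rfl⟩
  by_cases hu0 : 0 ≤ φ u
  · have hw0 := h.1 hu0
    refine iff_of_true ?_ hu0
    by_contra! hv0
    obtain ⟨z, ⟨hz1, hz2⟩, hz0⟩ := intermediate_value_Icc' huv
      (hφ.mono (Set.Icc_subset_Icc_right hvw)) ⟨hv0.le, hu0⟩
    have hzv : z < v := lt_of_le_of_ne hz2 (by rintro rfl; exact hv0.ne hz0)
    obtain ⟨e, he⟩ := hz z ⟨hz1, hz2.trans hvw⟩ hz0
    have h1 := he v hv hzv.ne'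
    have h2 := he w hw (hzv.trans_le hvw).ne'
    have he0 : e < 0 := by
      by_contra! he0
      nlinarith [mul_nonneg he0 (sub_nonneg.2 hzv.le)]
    nlinarith [mul_nonneg (neg_nonneg.2 he0.le) (sub_nonneg.2 (hzv.le.trans hvw))]
  · have hw0 : φ w < 0 := lt_of_not_ge fun hw0 => hu0 (h.2 hw0)
    refine iff_of_false ?_ hu0
    intro hv0
    push Not at hu0
    obtain ⟨z, ⟨hz1, hz2⟩, hz0⟩ := intermediate_value_Icc huv
      (hφ.mono (Set.Icc_subset_Icc_right hvw)) ⟨hu0.le, hv0⟩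
    have huz : u < z := lt_of_le_of_ne hz1 (by rintro rfl; exact hu0.ne hz0)
    have hzw : z < w := lt_of_le_of_ne (hz2.trans hvw) (by rintro rfl; exact hw0.ne hz0)
    obtain ⟨e, he⟩ := hz z ⟨hz1, hzw.le⟩ hz0
    have h1 := he u hu huz.ne
    have h2 := he w hw hzw.ne'
    rcases le_total 0 e with he0 | he0
    · nlinarith [mul_nonneg he0 (sub_nonneg.2 hzw.le)]
    · nlinarith [mul_nonneg (neg_nonneg.2 he0) (sub_nonneg.2 huz.le)]

/-- On a rectangle where every zero of `ψ` is a sign change in the same direction in both variables,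
three corners of equal weak sign force the fourth corner `(u₀, v₁)` to have that sign as well.
Otherwise there is a zero on the edge `u = u₀`; its direction, read off on that edge, produces the
wrong sign at the opposite point of the edge `u = u₁`. -/
theorem weakSign_corner {ψ : ℝ → ℝ → ℝ} {u₀ u₁ v₀ v₁ : ℝ} (hu : u₀ ≤ u₁) (hv : v₀ ≤ v₁)
    (hψ : ∀ u ∈ Set.Icc u₀ u₁, ContinuousOn (fun v => ψ u v) (Set.Icc v₀ v₁))
    (hz : ∀ u ∈ Set.Icc u₀ u₁, ∀ v ∈ Set.Icc v₀ v₁, ψ u v = 0 →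
      ∃ e : ℝ, (∀ s ∈ Set.Icc u₀ u₁, s ≠ u → 0 < e * (s - u) * ψ s v) ∧
        ∀ s ∈ Set.Icc v₀ v₁, s ≠ v → 0 < e * (s - v) * ψ u s)
    (h₀ : 0 ≤ ψ u₁ v₀ ↔ 0 ≤ ψ u₀ v₀) (h₁ : 0 ≤ ψ u₁ v₁ ↔ 0 ≤ ψ u₀ v₀) :
    0 ≤ ψ u₀ v₁ ↔ 0 ≤ ψ u₀ v₀ := by
  have hu₀ : u₀ ∈ Set.Icc u₀ u₁ := ⟨le_rfl, hu⟩
  have hu₁ : u₁ ∈ Set.Icc u₀ u₁ := ⟨hu, le_rfl⟩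
  have hv₀ : v₀ ∈ Set.Icc v₀ v₁ := ⟨le_rfl, hv⟩
  have hv₁ : v₁ ∈ Set.Icc v₀ v₁ := ⟨hv, le_rfl⟩
  rcases hu.eq_or_lt with rfl | hlt
  · exact h₁
  -- the weak sign is constant along the edge `u = u₁`
  have hedge : ∀ v ∈ Set.Icc v₀ v₁, (0 ≤ ψ u₁ v ↔ 0 ≤ ψ u₀ v₀) := fun v hv' =>
    (weakSign_of_endpoints hv'.1 hv'.2 (hψ u₁ hu₁)
      (fun z hz' h0 => (hz u₁ hu₁ z hz' h0).imp fun e he => he.2) (h₀.trans h₁.symm)).trans h₀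
  by_cases h00 : 0 ≤ ψ u₀ v₀
  · refine iff_of_true ?_ h00
    by_contra! h01
    obtain ⟨z, hzm, hz0⟩ := intermediate_value_Icc' hv (hψ u₀ hu₀) ⟨h01.le, h00⟩
    have hzv : z < v₁ := lt_of_le_of_ne hzm.2 (by rintro rfl; exact h01.ne hz0)
    obtain ⟨e, he1, he2⟩ := hz u₀ hu₀ z hzm hz0
    have h1 := he2 v₁ hv₁ hzv.ne'
    have h2 := he1 u₁ hu₁ hlt.ne'
    have h3 := (hedge z hzm).2 h00
    have he0 : e < 0 := by
      by_contra! he0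
      nlinarith [mul_nonneg he0 (sub_nonneg.2 hzv.le)]
    nlinarith [mul_nonneg (neg_nonneg.2 he0.le) (sub_nonneg.2 hlt.le)]
  · refine iff_of_false ?_ h00
    intro h01
    have h00' := not_le.1 h00
    obtain ⟨z, hzm, hz0⟩ := intermediate_value_Icc hv (hψ u₀ hu₀) ⟨h00'.le, h01⟩
    have hzv : v₀ < z := lt_of_le_of_ne hzm.1 (by rintro rfl; exact h00'.ne hz0)
    obtain ⟨e, he1, he2⟩ := hz u₀ hu₀ z hzm hz0
    have h1 := he2 v₀ hv₀ hzv.ne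
    have h2 := he1 u₁ hu₁ hlt.ne'
    have h3 : ψ u₁ z < 0 := lt_of_not_ge fun h => h00 ((hedge z hzm).1 h)
    rcases le_total 0 e with he0 | he0
    · nlinarith [mul_nonneg he0 (sub_nonneg.2 hlt.le)]
    · nlinarith [mul_nonneg (neg_nonneg.2 he0) (sub_nonneg.2 hzv.le)]

/-- A configuration in `J`: an increasing tuple of points of `J`. -/
def IsConfig {n : ℕ} (J : Set ℝ) (X : Fin n → ℝ) : Prop :=
  StrictMono X ∧ ∀ i, X i ∈ J

open Function in
theorem IsConfig.update_of_mem_Icc {n : ℕ} {J : Set ℝ} [J.OrdConnected] {X : Fin n → ℝ} {k : Fin n}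
    {u v s : ℝ} (hu : IsConfig J (update X k u)) (hv : IsConfig J (update X k v))
    (hs : s ∈ Set.Icc u v) : IsConfig J (update X k s) := by
  refine ⟨fun i j hij => ?_, fun i => ?_⟩
  · have h1 := hu.1 hij
    have h2 := hv.1 hij
    simp only [update_apply] at h1 h2 ⊢
    split_ifs at h1 h2 ⊢ with hi hj
    · exact absurd hij (by rw [hi, hj]; exact lt_irrefl _)
    · exact hs.2.trans_lt h2
    · exact h1.trans_le hs.1
    · exact h1
  · have h1 := hu.2 i
    have h2 := hv.2 i
    simp only [update_apply] at h1 h2 ⊢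
    split_ifs at h1 h2 ⊢ with hi
    · exact Set.OrdConnected.out ‹_› h1 h2 hs
    · exact h1

open Function in
/-- `D` vanishes on configurations in `J` only by changing sign, and it does so in the same direction
in all coordinates: at a zero `X`, moving any single coordinate `X k` to the right makes `e * D`
positive, moving it to the left makes `e * D` negative, for as long as the tuple is increasing. -/
structure IsTransversal {n : ℕ} (J : Set ℝ) (D : (Fin n → ℝ) → ℝ) : Prop where
  continuousOn : ∀ X k, ContinuousOn (fun s => D (update X k s)) J
  exists_direction : ∀ X, IsConfig J X → D X = 0 → ∃ e : ℝ, ∀ k s, IsConfig J (update X k s) →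
    s ≠ X k → 0 < e * (s - X k) * D (update X k s)

open Classical in
/-- `1` if the weak signs of `D` at `X` and `Y` differ, and `0` otherwise. A zero of `D` counts as
positive. -/
noncomputable def signChange {n : ℕ} (D : (Fin n → ℝ) → ℝ) (X Y : Fin n → ℝ) : ℕ :=
  if (0 ≤ D X ↔ 0 ≤ D Y) then 0 else 1

theorem signChange_self {n : ℕ} (D : (Fin n → ℝ) → ℝ) (X : Fin n → ℝ) : signChange D X X = 0 := by
  simp [signChange]

theorem signChange_triangle {n : ℕ} (D : (Fin n → ℝ) → ℝ) (X Y Z : Fin n → ℝ) :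
    signChange D X Z ≤ signChange D X Y + signChange D Y Z := by
  unfold signChange
  split_ifs <;> first | omega | tauto

section
open Function

variable {n : ℕ} {J : Set ℝ} {D : (Fin n → ℝ) → ℝ}

/-- The tuple with the first `m` coordinates of `b` and the remaining ones of `X`. -/
def mix (b X : Fin n → ℝ) (m : ℕ) : Fin n → ℝ := fun i => if (i : ℕ) < m then b i else X i

theorem mix_zero (b X : Fin n → ℝ) : mix b X 0 = X := by ext; simp [mix]

theorem mix_of_le (b X : Fin n → ℝ) {m : ℕ} (hm : n ≤ m) : mix b X m = b := by
  ext i; simp [mix, i.2.trans_le hm]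

theorem IsConfig.mix {b X : Fin n → ℝ} (hb : IsConfig J b) (hX : IsConfig J X) (hbX : b ≤ X)
    (m : ℕ) : IsConfig J (mix b X m) := by
  refine ⟨fun i j hij => ?_, fun i => ?_⟩
  · have hij' : (i : ℕ) < j := hij
    simp only [_root_.mix]
    split_ifs
    · exact hb.1 hij
    · exact (hb.1 hij).trans_le (hbX j)
    · omega
    · exact hX.1 hij
  · simp only [_root_.mix]
    split_ifs
    · exact hb.2 i
    · exact hX.2 i

variable [J.OrdConnected]

open Classical in
theorem ite_iff_add_eq {a b c d : Prop} (h₁ : (c ↔ a) → (d ↔ a) → (b ↔ a))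
    (h₂ : (b ↔ a) → (d ↔ a) → (c ↔ a)) :
    (if (a ↔ b) then 0 else 1) + (if (b ↔ d) then 0 else 1) =
      (if (a ↔ c) then 0 else 1) + (if (c ↔ d) then 0 else 1) := by
  by_cases a <;> by_cases b <;> by_cases c <;> by_cases d <;> simp_all

/-- A single coordinate moving to the right meets at most one sign change. -/
theorem IsTransversal.signChange_add (hD : IsTransversal J D) {X : Fin n → ℝ} {k : Fin n}
    {u v w : ℝ} (huv : u ≤ v) (hvw : v ≤ w) (hu : IsConfig J (update X k u))
    (hw : IsConfig J (update X k w)) :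
    signChange D (update X k u) (update X k v) + signChange D (update X k v) (update X k w)
      = signChange D (update X k u) (update X k w) := by
  have hJ : Set.Icc u w ⊆ J := fun s hs => by
    simpa using (hu.update_of_mem_Icc hw hs).2 k
  have key := weakSign_of_endpoints (φ := fun s => D (update X k s)) huv hvw
    ((hD.continuousOn X k).mono hJ) (fun z hz h0 => by
      obtain ⟨e, he⟩ := hD.exists_direction _ (hu.update_of_mem_Icc hw hz) h0
      refine ⟨e, fun s hs hsz => ?_⟩
      simpa using he k s (by simpa using hu.update_of_mem_Icc hw hs) (by simpa using hsz))
  unfold signChange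
  split_ifs <;> first | omega | tauto

/-- Both monotone paths around a rectangle of configurations meet the same number of sign changes. -/
theorem IsTransversal.signChange_square (hD : IsTransversal J D) {X : Fin n → ℝ} {j k : Fin n}
    (hjk : j ≠ k) {u₀ u₁ v₀ v₁ : ℝ} (hu : u₀ ≤ u₁) (hv : v₀ ≤ v₁)
    (h00 : IsConfig J (update (update X j u₀) k v₀)) (h01 : IsConfig J (update (update X j u₀) k v₁))
    (h10 : IsConfig J (update (update X j u₁) k v₀)) (h11 : IsConfig J (update (update X j u₁) k v₁)) :
    signChange D (update (update X j u₀) k v₀) (update (update X j u₀) k v₁) +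
        signChange D (update (update X j u₀) k v₁) (update (update X j u₁) k v₁)
      = signChange D (update (update X j u₀) k v₀) (update (update X j u₁) k v₀) +
        signChange D (update (update X j u₁) k v₀) (update (update X j u₁) k v₁) := by
  have hcomm : ∀ u v, update (update X j u) k v = update (update X k v) j u := fun u v =>
    update_comm hjk u v X
  have hidem : ∀ u s v, update (update (update X j u) k v) j s = update (update X j s) k v :=
    fun u s v => by rw [hcomm, update_idem, ← hcomm]
  have hconf : ∀ u ∈ Set.Icc u₀ u₁, ∀ v ∈ Set.Icc v₀ v₁,
      IsConfig J (update (update X j u) k v) := by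
    intro u hu' v hv'
    have h0 : IsConfig J (update (update X j u) k v₀) := by
      rw [hcomm] at h00 h10 ⊢; exact h00.update_of_mem_Icc h10 hu'
    have h1 : IsConfig J (update (update X j u) k v₁) := by
      rw [hcomm] at h01 h11 ⊢; exact h01.update_of_mem_Icc h11 hu'
    exact h0.update_of_mem_Icc h1 hv'
  have hvJ : Set.Icc v₀ v₁ ⊆ J := fun s hs => by
    simpa using (hconf u₀ ⟨le_rfl, hu⟩ s hs).2 k
  have huJ : Set.Icc u₀ u₁ ⊆ J := fun s hs => by
    simpa [hjk] using (hconf s hs v₀ ⟨le_rfl, hv⟩).2 j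
  have hz : ∀ u ∈ Set.Icc u₀ u₁, ∀ v ∈ Set.Icc v₀ v₁, D (update (update X j u) k v) = 0 →
      ∃ e : ℝ, (∀ s ∈ Set.Icc u₀ u₁, s ≠ u → 0 < e * (s - u) * D (update (update X j s) k v)) ∧
        ∀ s ∈ Set.Icc v₀ v₁, s ≠ v → 0 < e * (s - v) * D (update (update X j u) k s) := by
    intro u hu' v hv' h0
    obtain ⟨e, he⟩ := hD.exists_direction _ (hconf u hu' v hv') h0
    refine ⟨e, fun s hs hsu => ?_, fun s hs hsv => ?_⟩
    · have := he j s (by rw [hidem]; exact hconf s hs v hv') (by simpa [hjk] using hsu)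
      rw [hidem] at this
      simpa [hjk] using this
    · have := he k s (by
        rw [update_idem]; exact hconf u hu' s hs) (by simpa using hsv)
      simpa using this
  have key1 := weakSign_corner (ψ := fun u v => D (update (update X j u) k v)) hu hv
    (fun u _ => (hD.continuousOn _ k).mono hvJ) hz
  have key2 := weakSign_corner (ψ := fun v u => D (update (update X j u) k v)) hv hu
    (fun v _ => by
      simp only [hcomm]
      exact (hD.continuousOn _ j).mono huJ)
    (fun v hv' u hu' h0 => (hz u hu' v hv' h0).imp fun e he => he.symm)
  exact ite_iff_add_eq key1 key2

/-- The number of sign changes of `D` along the path from `b` to `X` that moves one coordinate at a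
time, the last coordinate first. -/
noncomputable def pathSignChanges (D : (Fin n → ℝ) → ℝ) (b X : Fin n → ℝ) : ℕ :=
  ∑ m ∈ Finset.Ico 0 n, signChange D (mix b X (m + 1)) (mix b X m)

theorem pathSignChanges_le (D : (Fin n → ℝ) → ℝ) (b X : Fin n → ℝ) :
    pathSignChanges D b X ≤ n := by
  refine (Finset.sum_le_card_nsmul _ _ 1 fun m _ => ?_).trans (by simp)
  unfold signChange
  split_ifs <;> simp

/-- Prolonging the path from `b` to `X` by a move of one coordinate to the right gives as many sign
changes as the standard path to the new end: the two paths differ by rectangles. -/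
theorem IsTransversal.pathSignChanges_update (hD : IsTransversal J D) {b X : Fin n → ℝ}
    {k : Fin n} {y : ℝ} (hb : IsConfig J b) (hX : IsConfig J X) (hX' : IsConfig J (update X k y))
    (hbX : b ≤ X) (hy : X k ≤ y) :
    pathSignChanges D b (update X k y) =
      pathSignChanges D b X + signChange D X (update X k y) := by
  have hbX' : b ≤ update X k y := fun i => by
    rcases eq_or_ne i k with rfl | hik
    · simpa using (hbX i).trans hy
    · simpa [hik] using hbX i
  have hlt : ∀ m, (k : ℕ) < m → mix b (update X k y) m = mix b X m := fun m hm => by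
    ext i
    rcases eq_or_ne i k with rfl | hik
    · simp [mix, hm]
    · simp [mix, hik]
  have hge : ∀ m, m ≤ (k : ℕ) → mix b (update X k y) m = update (mix b X m) k y := fun m hm => by
    ext i
    rcases eq_or_ne i k with rfl | hik
    · simp [mix, hm.not_gt]
    · simp [mix, hik]
  have hself : ∀ m, m ≤ (k : ℕ) → update (mix b X m) k (X k) = mix b X m := fun m hm => by
    rw [update_eq_self_iff]; simp [mix, hm.not_gt]
  have main : ∀ j, j ≤ n →
      ∑ m ∈ Finset.Ico j n,
          signChange D (mix b (update X k y) (m + 1)) (mix b (update X k y) m) =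
        ∑ m ∈ Finset.Ico j n, signChange D (mix b X (m + 1)) (mix b X m) +
          signChange D (mix b X j) (mix b (update X k y) j) := by
    intro j hj
    induction hj using Nat.decreasingInduction with
    | self => simp [mix_of_le, signChange_self]
    | of_succ j hj ih =>
      rw [Finset.sum_eq_sum_Ico_succ_bot hj, Finset.sum_eq_sum_Ico_succ_bot hj, ih]
      have hstep : ∀ Y : Fin n → ℝ, mix b Y j = update (mix b Y (j + 1)) ⟨j, hj⟩ (Y ⟨j, hj⟩) := by
        intro Y
        ext i
        rcases eq_or_ne i ⟨j, hj⟩ with rfl | hij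
        · simp [mix]
        · have : (i : ℕ) ≠ j := fun h => hij (Fin.ext h)
          simp only [mix, update_of_ne hij]
          congr 1
          simp only [eq_iff_iff]
          omega
      have hstep' : ∀ Y : Fin n → ℝ,
          mix b Y (j + 1) = update (mix b Y (j + 1)) ⟨j, hj⟩ (b ⟨j, hj⟩) := by
        intro Y
        rw [eq_comm, update_eq_self_iff]; simp [mix]
      suffices h : signChange D (mix b X (j + 1)) (mix b (update X k y) (j + 1)) +
          signChange D (mix b (update X k y) (j + 1)) (mix b (update X k y) j) =
          signChange D (mix b X (j + 1)) (mix b X j) +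
            signChange D (mix b X j) (mix b (update X k y) j) by omega
      have c00 := hb.mix hX hbX (j + 1)
      have c10 := hb.mix hX hbX j
      have c01 := hb.mix hX' hbX' (j + 1)
      have c11 := hb.mix hX' hbX' j
      rcases lt_trichotomy (k : ℕ) j with hkj | hkj | hkj
      · rw [hlt _ hkj, hlt (j + 1) (by omega), signChange_self, signChange_self]
        omega
      · have hk : k = ⟨j, hj⟩ := Fin.ext hkj
        have e1 := hlt (j + 1) (by omega)
        have e2 := hge j (by omega)
        have e3 := hself j (by omega)
        have e4 := hstep X
        have e5 := hstep' X
        rw [← hk] at e4 e5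
        have e6 : mix b (update X k y) j = update (mix b X (j + 1)) k y := by
          rw [e2, e4, update_idem]
        rw [e6] at c11 ⊢
        rw [e1, signChange_self, e4, zero_add]
        rw [e4] at c10
        have := hD.signChange_add (X := mix b X (j + 1)) (k := k) (hbX k) hy
          (by rw [← e5]; exact c00) c11
        rw [← e5] at this
        exact this.symm
      · have hne : (⟨j, hj⟩ : Fin n) ≠ k := fun h => by
          rw [← h] at hkj; exact lt_irrefl _ hkj
        have e0 : update X k y ⟨j, hj⟩ = X ⟨j, hj⟩ := update_of_ne hne _ _
        set Y := mix b X (j + 1) with hY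
        have f00 : Y = update (update Y ⟨j, hj⟩ (b ⟨j, hj⟩)) k (X k) := by
          rw [← hstep' X, hself _ (by omega)]
        have f10 : mix b X j = update (update Y ⟨j, hj⟩ (X ⟨j, hj⟩)) k (X k) := by
          rw [← hstep X, hself _ (by omega)]
        have f01 : mix b (update X k y) (j + 1) =
            update (update Y ⟨j, hj⟩ (b ⟨j, hj⟩)) k y := by
          rw [hge _ (by omega), ← hstep' X]
        have f11 : mix b (update X k y) j = update (update Y ⟨j, hj⟩ (X ⟨j, hj⟩)) k y := by
          rw [hge _ (by omega), ← hstep X]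
        rw [f01] at c01 ⊢
        rw [f11] at c11 ⊢
        rw [f10] at c10 ⊢
        have := hD.signChange_square hne (hbX ⟨j, hj⟩) hy (by rw [← f00]; exact c00) c01 c10 c11
        rw [← f00] at this
        exact this
  have := main 0 (Nat.zero_le n)
  simpa [pathSignChanges, mix_zero] using this

theorem IsTransversal.pathSignChanges_add_le (hD : IsTransversal J D) {b X Y : Fin n → ℝ}
    (hb : IsConfig J b) (hX : IsConfig J X) (hY : IsConfig J Y) (hbX : b ≤ X) (hXY : X ≤ Y) :
    pathSignChanges D b X + signChange D X Y ≤ pathSignChanges D b Y := by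
  -- raise the coordinates of `X` to those of `Y` one at a time, the last coordinate first
  have main : ∀ j, j ≤ n → pathSignChanges D b X + signChange D X (mix X Y j) ≤
      pathSignChanges D b (mix X Y j) := by
    intro j hj
    induction hj using Nat.decreasingInduction with
    | self => simp [mix_of_le, signChange_self]
    | of_succ j hj ih =>
      have hstep : mix X Y j = update (mix X Y (j + 1)) ⟨j, hj⟩ (Y ⟨j, hj⟩) := by
        ext i
        rcases eq_or_ne i ⟨j, hj⟩ with rfl | hij
        · simp [mix]
        · have : (i : ℕ) ≠ j := fun h => hij (Fin.ext h)
          simp only [mix, update_of_ne hij]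
          congr 1
          simp only [eq_iff_iff]
          omega
      have hle : b ≤ mix X Y (j + 1) := fun i => by
        simp only [mix]
        split_ifs
        · exact hbX i
        · exact (hbX i).trans (hXY i)
      have hc := hX.mix hY hXY j
      rw [hstep] at hc
      have := hD.pathSignChanges_update hb (hX.mix hY hXY (j + 1)) hc hle (by
        simpa [mix] using hXY ⟨j, hj⟩)
      rw [← hstep] at this
      have := signChange_triangle D X (mix X Y (j + 1)) (mix X Y j)
      omega
  simpa [mix_zero] using main 0 (Nat.zero_le n)

/-- A pointwise increasing sequence of configurations with alternating weak signs of `D` has at most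
`n` sign changes, `n` being the number of coordinates: the standard path between its ends has only
`n` moves. -/
theorem IsTransversal.length_le (hD : IsTransversal J D) {N : ℕ} {A : ℕ → Fin n → ℝ}
    (hA : ∀ i ≤ N, IsConfig J (A i)) (hmono : ∀ i < N, A i ≤ A (i + 1))
    (halt : ∀ i < N, ¬ (0 ≤ D (A i) ↔ 0 ≤ D (A (i + 1)))) : N ≤ n := by
  have main : ∀ i ≤ N, A 0 ≤ A i ∧ i ≤ pathSignChanges D (A 0) (A i) := by
    intro i
    induction i with
    | zero => exact fun _ => ⟨le_rfl, Nat.zero_le _⟩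
    | succ i ih =>
      intro hi
      obtain ⟨h1, h2⟩ := ih (by omega)
      refine ⟨h1.trans (hmono i hi), ?_⟩
      have h3 := hD.pathSignChanges_add_le (hA 0 (Nat.zero_le _)) (hA i (by omega))
        (hA (i + 1) hi) h1 (hmono i hi)
      have h4 : signChange D (A i) (A (i + 1)) = 1 := if_neg (halt i hi)
      omega
  exact (main N le_rfl).2.trans (pathSignChanges_le _ _ _)

end

/-! ### Zeros and small perturbations -/

theorem exists_zero_of_mul_neg {F : ℝ → ℝ} {x y : ℝ} (hxy : x < y)
    (hF : ContinuousOn F (Set.Icc x y)) (h : F x * F y < 0) : ∃ z ∈ Set.Ioo x y, F z = 0 := by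
  rcases mul_neg_iff.1 h with ⟨hx, hy⟩ | ⟨hx, hy⟩
  · exact intermediate_value_Ioo' hxy.le hF ⟨hy, hx⟩
  · exact intermediate_value_Ioo hxy.le hF ⟨hx, hy⟩

theorem exists_zeros_of_alternating {F : ℝ → ℝ} (σ : ℝ) (x : ℕ → ℝ) (k : ℕ)
    (hx : ∀ i < k, x i < x (i + 1)) (hF : ContinuousOn F (Set.Icc (x 0) (x k)))
    (hs : ∀ i ≤ k, 0 < σ * (-1) ^ i * F (x i)) :
    ∃ Z : Finset ℝ, Z.card = k ∧ ∀ z ∈ Z, z ∈ Set.Ioo (x 0) (x k) ∧ F z = 0 := by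
  have hle : ∀ i ≤ k, x 0 ≤ x i := by
    intro i
    induction i with
    | zero => exact fun _ => le_rfl
    | succ i ih => exact fun hi => (ih (by omega)).trans (hx i hi).le
  induction k with
  | zero => exact ⟨∅, by simp⟩
  | succ k ih =>
    have hk := hx k (Nat.lt_succ_self k)
    obtain ⟨Z, hZ, hZ'⟩ := ih (fun i hi => hx i (by omega))
      (hF.mono (Set.Icc_subset_Icc_right hk.le)) (fun i hi => hs i (by omega))
      (fun i hi => hle i (by omega))
    obtain ⟨z, hz, hz0⟩ := exists_zero_of_mul_neg hk
      (hF.mono (Set.Icc_subset_Icc_left (hle k (by omega)))) (by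
        have h1 := hs k (by omega)
        have h2 := hs (k + 1) le_rfl
        have h3 := mul_pos h1 h2
        have h4 : σ * (-1) ^ k * F (x k) * (σ * (-1) ^ (k + 1) * F (x (k + 1))) =
            -((σ * (-1) ^ k) ^ 2 * (F (x k) * F (x (k + 1)))) := by ring
        rw [h4] at h3
        by_contra! h5
        have := mul_nonneg (sq_nonneg (σ * (-1) ^ k)) h5
        linarith)
    have hzZ : z ∉ Z := fun h => by
      have := (hZ' z h).1.2
      exact absurd hz.1 this.not_gt
    refine ⟨insert z Z, by rw [Finset.card_insert_of_notMem hzZ, hZ], fun y hy => ?_⟩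
    rcases Finset.mem_insert.1 hy with rfl | hy
    · exact ⟨⟨(hle k (by omega)).trans_lt hz.1, hz.2⟩, hz0⟩
    · exact ⟨⟨(hZ' y hy).1.1, (hZ' y hy).1.2.trans hk⟩, (hZ' y hy).2⟩

/-- Adding a small multiple of `h` to `f` keeps prescribed signs where `f` has them, and at zeros of
`f` produces the signs that `h` has there. -/
theorem exists_perturbation {ι : Type*} [Finite ι] {σ f h : ι → ℝ}
    (H : ∀ i, 0 < σ i * f i ∨ f i = 0 ∧ 0 < σ i * h i) :
    ∃ ε : ℝ, 0 < ε ∧ ∀ i, 0 < σ i * (f i + ε * h i) := by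
  have hev : ∀ᶠ ε : ℝ in nhdsWithin 0 (Set.Ioi 0), ∀ i, 0 < σ i * (f i + ε * h i) := by
    rw [Filter.eventually_all]
    intro i
    rcases H i with hi | ⟨h0, hi⟩
    · have hc : Continuous fun ε : ℝ => σ i * (f i + ε * h i) := by fun_prop
      exact (hc.continuousAt.eventually (lt_mem_nhds (by simpa using hi))).filter_mono
        nhdsWithin_le_nhds
    · filter_upwards [self_mem_nhdsWithin] with ε hε
      have : σ i * (f i + ε * h i) = ε * (σ i * h i) := by rw [h0]; ring
      rw [this]
      exact mul_pos hε hi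
  obtain ⟨ε, h1, h2⟩ := (hev.and self_mem_nhdsWithin).exists
  exact ⟨ε, h2, h1⟩

/-- Every nonzero function of `W` has at most `m` zeros in `I`. For `m + 1 = dim W` this says that
`W` is a Chebyshev space on `I`. -/
def HasAtMostZeros (W : Submodule ℝ (ℝ → ℝ)) (I : Set ℝ) (m : ℕ) : Prop :=
  ∀ w ∈ W, w ≠ 0 → ∀ F : Finset ℝ, (∀ x ∈ F, x ∈ I ∧ w x = 0) → F.card ≤ m

theorem HasAtMostZeros.mono {W W' : Submodule ℝ (ℝ → ℝ)} {I I' : Set ℝ} {m : ℕ}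
    (h : HasAtMostZeros W I m) (hW : W' ≤ W) (hI : I' ⊆ I) : HasAtMostZeros W' I' m :=
  fun w hw h0 F hF => h w (hW hw) h0 F fun x hx => ⟨hI (hF x hx).1, (hF x hx).2⟩

/-- The functions of `W` that vanish at `a`. -/
def vanishingAt (W : Submodule ℝ (ℝ → ℝ)) (a : ℝ) : Submodule ℝ (ℝ → ℝ) :=
  W ⊓ LinearMap.ker (LinearMap.proj a)

theorem mem_vanishingAt {W : Submodule ℝ (ℝ → ℝ)} {a : ℝ} {w : ℝ → ℝ} :
    w ∈ vanishingAt W a ↔ w ∈ W ∧ w a = 0 := by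
  simp [vanishingAt]

theorem exists_vanishing {W : Submodule ℝ (ℝ → ℝ)} {F : Finset ℝ}
    (hF : F.card < Module.finrank ℝ W) : ∃ w ∈ W, w ≠ 0 ∧ ∀ x ∈ F, w x = 0 := by
  have : FiniteDimensional ℝ W := Module.finite_of_finrank_pos (by omega)
  let φ : W →ₗ[ℝ] (F → ℝ) :=
    LinearMap.pi fun x => (LinearMap.proj (x : ℝ)).comp W.subtype
  have hker : LinearMap.ker φ ≠ ⊥ := LinearMap.ker_ne_bot_of_finrank_lt (by simpa using hF)
  obtain ⟨w, hw, hw0⟩ := Submodule.exists_mem_ne_zero_of_ne_bot hker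
  refine ⟨w, w.2, by simpa using hw0, fun x hx => ?_⟩
  have := congrFun (LinearMap.mem_ker.1 hw) ⟨x, hx⟩
  simpa [φ] using this

/-! ### Zeros of a function with the maximal number of zeros are sign changes -/

section
open Function

variable {W : Submodule ℝ (ℝ → ℝ)} {J : Set ℝ} [J.OrdConnected] {m : ℕ} {a : ℝ}

theorem card_image_others {X : Fin (m + 2) → ℝ} (hX : Injective X) {j k : Fin (m + 2)}
    (hjk : j ≠ k) : (((Finset.univ.erase j).erase k).image X).card = m := by
  rw [Finset.card_image_of_injective _ hX, Finset.card_erase_of_mem (by simp [hjk.symm]),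
    Finset.card_erase_of_mem (by simp)]
  simp

/-- Because `vanishingAt W a` is a Chebyshev space on `J`, a function can vanish at all points of a
configuration except two neighbours, and then it has the same strict sign at these two. -/
theorem exists_vanishing_others (hdim : Module.finrank ℝ W = m + 2)
    (hcont : ∀ w ∈ W, ContinuousOn w J) (hWa : HasAtMostZeros (vanishingAt W a) J m)
    {X : Fin (m + 2) → ℝ} (hX : IsConfig J X) {j k : Fin (m + 2)} (hjk : (j : ℕ) + 1 = k) :
    ∃ h ∈ W, (∀ i, i ≠ j → i ≠ k → h (X i) = 0) ∧ 0 < h (X j) * h (X k) := by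
  have hne : j ≠ k := fun h => by rw [h] at hjk; omega
  have hlt : j < k := Fin.lt_def.2 (by omega)
  set R := ((Finset.univ.erase j).erase k).image X with hR
  have hcard : R.card = m := card_image_others hX.1.injective hne
  obtain ⟨h, hW, h0, hz⟩ := exists_vanishing (W := W) (F := insert a R)
    ((Finset.card_insert_le _ _).trans_lt (by omega))
  have hmem : h ∈ vanishingAt W a := mem_vanishingAt.2 ⟨hW, hz a (by simp)⟩
  have hRz : ∀ i, i ≠ j → i ≠ k → h (X i) = 0 := fun i hij hik =>
    hz _ (Finset.mem_insert_of_mem (Finset.mem_image_of_mem _ (by simp [hij, hik])))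
  have hnz : ∀ z ∈ Set.Icc (X j) (X k), h z ≠ 0 := by
    intro z hzI hz0
    have hzR : z ∉ R := by
      intro hzR
      obtain ⟨i, hi, rfl⟩ := Finset.mem_image.1 hzR
      simp only [Finset.mem_erase, Finset.mem_univ, and_true] at hi
      have h1 := hX.1.le_iff_le.1 hzI.1
      have h2 := hX.1.le_iff_le.1 hzI.2
      rw [Fin.le_def] at h1 h2
      have h3 : (i : ℕ) ≠ j := fun h => hi.2 (Fin.ext h)
      have h4 : (i : ℕ) ≠ k := fun h => hi.1 (Fin.ext h)
      omega
    have := hWa h hmem h0 (insert z R) (by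
      intro x hx
      rcases Finset.mem_insert.1 hx with rfl | hx
      · exact ⟨Set.OrdConnected.out ‹_› (hX.2 j) (hX.2 k) hzI, hz0⟩
      · refine ⟨?_, hz x (Finset.mem_insert_of_mem hx)⟩
        obtain ⟨i, hi, rfl⟩ := Finset.mem_image.1 hx
        exact hX.2 i)
    rw [Finset.card_insert_of_notMem hzR] at this
    omega
  refine ⟨h, hW, hRz, ?_⟩
  have hj := hnz _ ⟨le_rfl, (hX.1 hlt).le⟩
  have hk := hnz _ ⟨(hX.1 hlt).le, le_rfl⟩
  by_contra! hneg
  obtain ⟨z, hzI, hz0⟩ := exists_zero_of_mul_neg (hX.1 hlt)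
    ((hcont h hW).mono (Set.OrdConnected.out ‹_› (hX.2 j) (hX.2 k)))
    (lt_of_le_of_ne hneg (mul_ne_zero hj hk))
  exact hnz z (Set.Ioo_subset_Icc_self hzI) hz0

/-- A common zero set `R` of `f` and `h`, together with three further zeros of `f + ε • h` caused by
four alternating signs, would exceed the bound `m + 2`. -/
theorem not_alternating_perturbation (hcont : ∀ w ∈ W, ContinuousOn w J)
    (hW : HasAtMostZeros W J (m + 2)) {f h : ℝ → ℝ} (hf : f ∈ W) (hh : h ∈ W) {R : Finset ℝ}
    (hR : R.card = m) (hRJ : ∀ x ∈ R, x ∈ J ∧ f x = 0 ∧ h x = 0) {x : Fin 4 → ℝ}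
    (hx : IsConfig J x) (hRx : ∀ y ∈ R, y ∉ Set.Ioo (x 0) (x 3)) (σ : ℝ)
    (H : ∀ i : Fin 4, 0 < σ * (-1) ^ (i : ℕ) * f (x i) ∨
      f (x i) = 0 ∧ 0 < σ * (-1) ^ (i : ℕ) * h (x i)) : False := by
  obtain ⟨ε, hε, hs⟩ := exists_perturbation (σ := fun i : Fin 4 => σ * (-1) ^ (i : ℕ))
    (f := fun i => f (x i)) (h := fun i => h (x i)) H
  have hF : f + ε • h ∈ W := W.add_mem hf (W.smul_mem ε hh)
  have hFx : ∀ i : Fin 4, 0 < σ * (-1) ^ (i : ℕ) * (f + ε • h) (x i) := fun i => by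
    simpa using hs i
  have hF0 : f + ε • h ≠ 0 := fun h0 => by have := hFx 0; rw [h0] at this; simp at this
  obtain ⟨Z, hZ, hZ'⟩ := exists_zeros_of_alternating (F := f + ε • h) σ
    (fun i => x (Fin.ofNat 4 i)) 3
    (fun i hi => by interval_cases i <;> exact hx.1 (by decide))
    ((hcont _ hF).mono (Set.OrdConnected.out ‹_› (hx.2 0) (hx.2 3)))
    (fun i hi => by interval_cases i; exacts [hFx 0, hFx 1, hFx 2, hFx 3])
  have hdisj : Disjoint R Z := Finset.disjoint_left.2 fun y hyR hyZ => hRx y hyR (hZ' y hyZ).1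
  have := hW _ hF hF0 (R ∪ Z) (by
    intro y hy
    rcases Finset.mem_union.1 hy with hy | hy
    · obtain ⟨h1, h2, h3⟩ := hRJ y hy
      exact ⟨h1, by simp [h2, h3]⟩
    · exact ⟨Set.OrdConnected.out ‹_› (hx.2 0) (hx.2 3)
        (Set.Ioo_subset_Icc_self (hZ' y hy).1), (hZ' y hy).2⟩)
  rw [Finset.card_union_of_disjoint hdisj] at this
  omega

/-- A function with `m + 2` zeros, the largest number allowed, changes sign at each of them.
Otherwise push it across zero at `X k` by a function `h` that has the same sign at `X k` and at a
neighbouring zero and vanishes at the others: the double zero at `X k` splits, and the zero at the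
neighbour moves inside the gap, which gives one zero too many. -/
theorem mul_neg_across_zero (hdim : Module.finrank ℝ W = m + 2)
    (hcont : ∀ w ∈ W, ContinuousOn w J) (hW : HasAtMostZeros W J (m + 2))
    (hWa : HasAtMostZeros (vanishingAt W a) J m)
    {X : Fin (m + 2) → ℝ} (hX : IsConfig J X) {k : Fin (m + 2)} {s s' : ℝ}
    {f : ℝ → ℝ} (hf : f ∈ W) (hfX : ∀ i, f (X i) = 0)
    (hs : IsConfig J (update X k s)) (hs' : IsConfig J (update X k s')) (hsk : s < X k)
    (hsk' : X k < s') (h0 : f s ≠ 0) (h0' : f s' ≠ 0) : f s * f s' < 0 := by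
  by_contra! hpos
  -- the neighbouring zero is the next one if `k` is the first index, and the previous one otherwise
  replace hpos : 0 < f s * f s' := lt_of_le_of_ne hpos (mul_ne_zero h0 h0').symm
  have hsJ : s ∈ J := by simpa using hs.2 k
  have hsJ' : s' ∈ J := by simpa using hs'.2 k
  have hleft : ∀ i, i < k → X i < s := fun i hi => by
    simpa [hi.ne] using hs.1 hi
  have hright : ∀ i, k < i → s' < X i := fun i hi => by
    simpa [hi.ne'] using hs'.1 hi
  rcases Nat.eq_zero_or_pos (k : ℕ) with hk0 | hk0
  · have hk1 : (k : ℕ) + 1 < m + 2 := by omega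
    obtain ⟨h, hh, hhX, hhp⟩ := exists_vanishing_others hdim hcont hWa hX
      (j := k) (k := ⟨k + 1, hk1⟩) rfl
    set l : Fin (m + 2) := ⟨k + 1, hk1⟩ with hl
    have hkl : k < l := Fin.lt_def.2 (Nat.lt_succ_self _)
    have hsl := hright l hkl
    refine not_alternating_perturbation hcont hW hf (W.smul_mem (-(f s * h (X k))) hh)
      (card_image_others hX.1.injective hkl.ne)
      (R := ((Finset.univ.erase k).erase l).image X) ?_ (x := ![s, X k, s', X l]) ?_ ?_ (f s) ?_
    · intro x hx
      obtain ⟨i, hi, rfl⟩ := Finset.mem_image.1 hx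
      simp only [Finset.mem_erase, Finset.mem_univ, and_true] at hi
      exact ⟨hX.2 i, hfX i, by simp [hhX i hi.2 hi.1]⟩
    · refine ⟨?_, ?_⟩
      · rw [Fin.strictMono_iff_lt_succ]
        intro i
        fin_cases i
        · exact hsk
        · exact hsk'
        · exact hsl
      · intro i
        fin_cases i
        · exact hsJ
        · exact hX.2 k
        · exact hsJ'
        · exact hX.2 l
    · intro y hy hyI
      obtain ⟨i, hi, rfl⟩ := Finset.mem_image.1 hy
      simp only [Finset.mem_erase, Finset.mem_univ, and_true] at hi
      have hik : (i : ℕ) ≠ k := fun h => hi.2 (Fin.ext h)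
      have h2 : X i < X l := hyI.2
      rw [hX.1.lt_iff_lt, Fin.lt_def] at h2
      have : (l : ℕ) = k + 1 := rfl
      omega
    · intro i
      have hfs : 0 < f s * f s := mul_self_pos.2 h0
      have hhk : h (X k) ≠ 0 := fun h => by simp [h] at hhp
      have hsq : 0 < (f s * h (X k)) ^ 2 := by positivity
      fin_cases i
      · left; simpa using hfs
      · right
        refine ⟨hfX k, ?_⟩
        simp
        nlinarith
      · left; simpa using hpos
      · right
        refine ⟨hfX l, ?_⟩
        simp
        have : 0 < f s ^ 2 * (h (X k) * h (X l)) := by positivity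
        nlinarith
  · obtain ⟨l, hl⟩ : ∃ l : Fin (m + 2), (l : ℕ) + 1 = k := ⟨⟨k - 1, by omega⟩, by simp; omega⟩
    obtain ⟨h, hh, hhX, hhp⟩ := exists_vanishing_others hdim hcont hWa hX hl
    have hkl : l < k := Fin.lt_def.2 (by omega)
    have hsl := hleft l hkl
    refine not_alternating_perturbation hcont hW hf (W.smul_mem (-(f s * h (X k))) hh)
      (card_image_others hX.1.injective hkl.ne)
      (R := ((Finset.univ.erase l).erase k).image X) ?_ (x := ![X l, s, X k, s']) ?_ ?_ (-f s) ?_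
    · intro x hx
      obtain ⟨i, hi, rfl⟩ := Finset.mem_image.1 hx
      simp only [Finset.mem_erase, Finset.mem_univ, and_true] at hi
      exact ⟨hX.2 i, hfX i, by simp [hhX i hi.2 hi.1]⟩
    · refine ⟨?_, ?_⟩
      · rw [Fin.strictMono_iff_lt_succ]
        intro i
        fin_cases i
        · exact hsl
        · exact hsk
        · exact hsk'
      · intro i
        fin_cases i
        · exact hX.2 l
        · exact hsJ
        · exact hX.2 k
        · exact hsJ'
    · intro y hy hyI
      obtain ⟨i, hi, rfl⟩ := Finset.mem_image.1 hy
      simp only [Finset.mem_erase, Finset.mem_univ, and_true] at hi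
      have hik : (i : ℕ) ≠ k := fun h => hi.1 (Fin.ext h)
      have h2 : X l < X i := hyI.1
      have h3 : X i < s' := hyI.2
      rw [hX.1.lt_iff_lt, Fin.lt_def] at h2
      exact absurd h3 (hright i (Fin.lt_def.2 (by omega))).not_gt
    · intro i
      have hfs : 0 < f s * f s := mul_self_pos.2 h0
      have hhk : h (X k) ≠ 0 := fun h => by simp [h] at hhp
      have hsq : 0 < (f s * h (X k)) ^ 2 := by positivity
      fin_cases i
      · right
        refine ⟨hfX l, ?_⟩
        simp
        have : 0 < f s ^ 2 * (h (X l) * h (X k)) := by positivity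
        nlinarith
      · left; simpa using hfs
      · right
        refine ⟨hfX k, ?_⟩
        simp
        nlinarith
      · left; simpa [pow_succ] using hpos

end

/-! ### The collocation determinant -/

/-- If the rows of `M` satisfy the linear relation `c`, then the determinants obtained by replacing
one row by `v` are proportional to the coefficients of the relation. -/
theorem Matrix.mul_det_updateRow_comm {ι R : Type*} [Fintype ι] [DecidableEq ι] [CommRing R]
    {M : Matrix ι ι R} {c : ι → R} (hc : Matrix.vecMul c M = 0) (j k : ι) (v : ι → R) :
    c k * (M.updateRow j v).det = c j * (M.updateRow k v).det := by
  rcases eq_or_ne j k with rfl | hjk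
  · rfl
  have hsum : ∑ i, c i • (M.updateRow j v) i = c j • (v - M j) := by
    have h1 : ∑ i, c i • M i = 0 := by
      rw [← hc]; ext l; simp [Matrix.vecMul, dotProduct]
    have h2 : ∀ i, c i • (M.updateRow j v) i = c i • M i + if i = j then c j • (v - M j) else 0 := by
      intro i
      rcases eq_or_ne i j with rfl | hij
      · simp [smul_sub]
      · simp [hij]
    simp only [h2, Finset.sum_add_distrib, h1, zero_add, Finset.sum_ite_eq', Finset.mem_univ,
      if_true]
  have h1 := Matrix.det_updateRow_sum (M.updateRow j v) k c
  rw [hsum, Matrix.det_updateRow_smul, sub_eq_add_neg, Matrix.det_updateRow_add,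
    ← neg_one_smul R (M j), Matrix.det_updateRow_smul] at h1
  have h2 : ((M.updateRow j v).updateRow k v).det = 0 :=
    Matrix.det_zero_of_row_eq hjk (by simp [hjk])
  have h3 : ((M.updateRow j v).updateRow k (M j)).det = -(M.updateRow k v).det := by
    have h4 : (M.updateRow j v).updateRow k (M j) =
        (M.updateRow k v).submatrix (Equiv.swap j k) id := by
      ext x y
      rcases eq_or_ne x k with rfl | hxk
      · simp [hjk]
      · rcases eq_or_ne x j with rfl | hxj
        · simp [hjk]
        · simp [hxk, hxj, Equiv.swap_apply_of_ne_of_ne]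
    rw [h4, Matrix.det_permute, Equiv.Perm.sign_swap hjk]
    simp
  rw [h2, h3] at h1
  simp only [smul_eq_mul] at h1
  linear_combination -h1

section
open Function

variable {W : Submodule ℝ (ℝ → ℝ)} {n : ℕ}

/-- The values of a basis of `W` at the points of a tuple, one row for each point. Its determinant
vanishes exactly if some nonzero function of `W` vanishes on the tuple. -/
noncomputable def collocationMatrix (b : Module.Basis (Fin n) ℝ W) (X : Fin n → ℝ) :
    Matrix (Fin n) (Fin n) ℝ :=
  Matrix.of fun i j => (b j : ℝ → ℝ) (X i)

theorem collocationMatrix_update (b : Module.Basis (Fin n) ℝ W) (X : Fin n → ℝ) (k : Fin n)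
    (s : ℝ) : collocationMatrix b (update X k s) =
      (collocationMatrix b X).updateRow k fun j => (b j : ℝ → ℝ) s := by
  ext i j
  rcases eq_or_ne i k with rfl | hik
  · simp [collocationMatrix]
  · simp [collocationMatrix, hik]

theorem apply_eq_sum_repr (b : Module.Basis (Fin n) ℝ W) {w : ℝ → ℝ} (hw : w ∈ W) (x : ℝ) :
    w x = ∑ j, b.repr ⟨w, hw⟩ j * (b j : ℝ → ℝ) x := by
  have h := congrArg (fun u : W => (u : ℝ → ℝ) x) (b.sum_repr ⟨w, hw⟩)
  simp only [Submodule.coe_sum, Submodule.coe_smul, Finset.sum_apply, Pi.smul_apply,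
    smul_eq_mul] at h
  exact h.symm

theorem det_collocationMatrix_update_mem (b : Module.Basis (Fin n) ℝ W) (X : Fin n → ℝ)
    (k : Fin n) : (fun s => (collocationMatrix b (update X k s)).det) ∈ W := by
  have h : (fun s => (collocationMatrix b (update X k s)).det) =
      ∑ j, (Matrix.cramer (collocationMatrix b X).transpose (fun l => if j = l then 1 else 0) k) •
        (b j : ℝ → ℝ) := by
    ext s
    rw [collocationMatrix_update, ← Matrix.cramer_transpose_apply,
      LinearMap.pi_apply_eq_sum_univ (Matrix.cramer _)]
    simp [mul_comm]
  rw [h]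
  exact W.sum_mem fun j _ => W.smul_mem _ (b j).2

theorem exists_ne_zero_of_det_collocationMatrix (b : Module.Basis (Fin n) ℝ W) {X : Fin n → ℝ}
    (h : (collocationMatrix b X).det = 0) : ∃ w ∈ W, w ≠ 0 ∧ ∀ i, w (X i) = 0 := by
  obtain ⟨v, hv, hv0⟩ := Matrix.exists_mulVec_eq_zero_iff.2 h
  refine ⟨(∑ j, v j • b j : W), Subtype.prop _, ?_, fun i => ?_⟩
  · intro h0
    have h1 : (∑ j, v j • b j : W) = 0 := Subtype.ext h0
    exact hv (funext (Fintype.linearIndependent_iff.1 b.linearIndependent v h1))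
  · have := congrFun hv0 i
    simpa [Matrix.mulVec, dotProduct, collocationMatrix, mul_comm] using this

variable {J : Set ℝ} {m : ℕ} {a : ℝ}

theorem HasAtMostZeros.le_of_injective {I : Set ℝ} {l : ℕ} (hW : HasAtMostZeros W I m) {w : ℝ → ℝ}
    (hw : w ∈ W) (h0 : w ≠ 0) {Y : Fin l → ℝ} (hY : Injective Y) (hYI : ∀ i, Y i ∈ I)
    (hz : ∀ i, w (Y i) = 0) : l ≤ m := by
  have := hW w hw h0 (Finset.univ.image Y) (by
    intro x hx
    obtain ⟨i, -, rfl⟩ := Finset.mem_image.1 hx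
    exact ⟨hYI i, hz i⟩)
  rwa [Finset.card_image_of_injective _ hY, Finset.card_univ, Fintype.card_fin] at this

/-- At a configuration with vanishing determinant, moving one point makes the determinant nonzero.
Otherwise there are two functions of `W` with `m + 1` zeros in common; either they are
proportional, with `m + 3` zeros, or some combination of them vanishes at `a` and contradicts the
Chebyshev property of `vanishingAt W a`. -/
theorem det_collocationMatrix_update_ne_zero (b : Module.Basis (Fin (m + 2)) ℝ W)
    (hW : HasAtMostZeros W J (m + 2)) (hWa : HasAtMostZeros (vanishingAt W a) J m)
    {X : Fin (m + 2) → ℝ} (hX : IsConfig J X) (h0 : (collocationMatrix b X).det = 0)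
    {k : Fin (m + 2)} {s : ℝ} (hs : IsConfig J (update X k s)) (hsk : s ≠ X k) :
    (collocationMatrix b (update X k s)).det ≠ 0 := by
  intro h1
  obtain ⟨f, hf, hf0, hfX⟩ := exists_ne_zero_of_det_collocationMatrix b h0
  obtain ⟨w, hw, hw0, hwX⟩ := exists_ne_zero_of_det_collocationMatrix b h1
  have hfa : f a ≠ 0 := fun hfa => by
    have := hWa.le_of_injective (mem_vanishingAt.2 ⟨hf, hfa⟩) hf0 hX.1.injective hX.2 hfX
    omega
  have hg : w a • f - f a • w = 0 := by
    by_contra hg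
    have := hWa.le_of_injective (w := w a • f - f a • w) (mem_vanishingAt.2
      ⟨W.sub_mem (W.smul_mem _ hf) (W.smul_mem _ hw), by simp [mul_comm]⟩) hg
      (Y := X ∘ k.succAbove) (hX.1.injective.comp Fin.succAbove_right_injective)
      (fun i => hX.2 _) (fun i => by
        have := hwX (k.succAbove i)
        rw [update_of_ne (Fin.succAbove_ne k i)] at this
        simp [this, hfX])
    omega
  have hfw : ∀ x, w a * f x = f a * w x := fun x => by
    have := congrFun hg x
    simpa [sub_eq_zero] using this
  have hws : w s = 0 := by simpa using hwX k
  have hwa : w a ≠ 0 := fun hwa => by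
    refine hw0 (funext fun x => ?_)
    have := hfw x
    rw [hwa, zero_mul] at this
    simpa [hfa] using this.symm
  have hfs : f s = 0 := by
    have := hfw s
    rw [hws, mul_zero] at this
    simpa [hwa] using this
  have hsX : ∀ i, X i ≠ s := fun i hi => by
    rcases eq_or_ne i k with rfl | hik
    · exact hsk hi.symm
    · exact hik (hs.1.injective (by simp [hik, hi]))
  have := hW.le_of_injective hf hf0 (Y := (Fin.cons s X : Fin (m + 3) → ℝ))
    (Fin.cons_injective_iff.2 ⟨by rintro ⟨i, hi⟩; exact hsX i hi, hX.1.injective⟩)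
    (by
      intro i
      refine Fin.cases ?_ (fun i => ?_) i
      · simpa using hs.2 k
      · simpa using hX.2 i)
    (by
      intro i
      refine Fin.cases ?_ (fun i => ?_) i
      · simpa using hfs
      · simpa using hfX i)
  omega

variable [J.OrdConnected]

theorem IsConfig.update_midpoint {X : Fin n → ℝ} (hX : IsConfig J X) {j k : Fin n}
    (hjk : (j : ℕ) + 1 = k) : IsConfig J (update X j ((X j + X k) / 2)) ∧
      IsConfig J (update X k ((X j + X k) / 2)) := by
  have hlt : X j < X k := hX.1 (Fin.lt_def.2 (by omega))
  have hJ : (X j + X k) / 2 ∈ J :=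
    Set.OrdConnected.out ‹_› (hX.2 j) (hX.2 k) ⟨by linarith, by linarith⟩
  constructor
  · refine ⟨fun p q hpq => ?_, fun p => ?_⟩
    · simp only [update_apply]
      split_ifs with h1 h2 h2
      · exact absurd hpq (by rw [h1, h2]; exact lt_irrefl _)
      · have : X k ≤ X q := hX.1.monotone (Fin.le_def.2 (by
          rw [h1, Fin.lt_def] at hpq; omega))
        linarith
      · have : X p < X j := hX.1 (h2 ▸ hpq)
        linarith
      · exact hX.1 hpq
    · simp only [update_apply]
      split_ifs
      · exact hJ
      · exact hX.2 p
  · refine ⟨fun p q hpq => ?_, fun p => ?_⟩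
    · simp only [update_apply]
      split_ifs with h1 h2 h2
      · exact absurd hpq (by rw [h1, h2]; exact lt_irrefl _)
      · have : X k < X q := hX.1 (h1 ▸ hpq)
        linarith
      · have : X p ≤ X j := hX.1.monotone (Fin.le_def.2 (by
          rw [h2, Fin.lt_def] at hpq; omega))
        linarith
      · exact hX.1 hpq
    · simp only [update_apply]
      split_ifs
      · exact hJ
      · exact hX.2 p

/-- The collocation determinant changes sign in the same direction in all coordinates. As a function
of the `k`-th point it is a multiple `c k` of one function that alternates in sign between the
zeros, and the Chebyshev property of `vanishingAt W a` forces the `c k` to alternate as well. -/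
theorem isTransversal_det_collocationMatrix (b : Module.Basis (Fin (m + 2)) ℝ W)
    (hcont : ∀ w ∈ W, ContinuousOn w J)
    (hW : HasAtMostZeros W J (m + 2)) (hWa : HasAtMostZeros (vanishingAt W a) J m) :
    IsTransversal J fun X => (collocationMatrix b X).det := by
  have hdim : Module.finrank ℝ W = m + 2 := by simpa using Module.finrank_eq_card_basis b
  refine ⟨fun X k => hcont _ (det_collocationMatrix_update_mem b X k), fun X hX h0 => ?_⟩
  set φ : Fin (m + 2) → ℝ → ℝ := fun k s => (collocationMatrix b (update X k s)).det with hφ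
  have hφW : ∀ k, φ k ∈ W := det_collocationMatrix_update_mem b X
  have hφX : ∀ k i, φ k (X i) = 0 := by
    intro k i
    simp only [hφ, collocationMatrix_update]
    rcases eq_or_ne i k with rfl | hik
    · have : (fun j => (b j : ℝ → ℝ) (X i)) = collocationMatrix b X i := rfl
      rw [this, Matrix.updateRow_eq_self, h0]
    · exact Matrix.det_updateRow_eq_zero hik
  have hφne : ∀ k s, IsConfig J (update X k s) → s ≠ X k → φ k s ≠ 0 := fun k s hs hsk =>
    det_collocationMatrix_update_ne_zero b hW hWa hX h0 hs hsk
  -- each `φ k` has constant sign on either side of `X k`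
  have hside : ∀ k s t, IsConfig J (update X k s) → IsConfig J (update X k t) → s ≤ t →
      (X k < s ∨ t < X k) → 0 < φ k s * φ k t := by
    intro k s t hs ht hst hk
    have hne : ∀ z ∈ Set.Icc s t, φ k z ≠ 0 := fun z hz =>
      hφne k z (hs.update_of_mem_Icc ht hz) (by
        rcases hk with hk | hk
        · exact (hk.trans_le hz.1).ne'
        · exact (hz.2.trans_lt hk).ne)
    by_contra! hneg
    have hneg' := lt_of_le_of_ne hneg
      (mul_ne_zero (hne s ⟨le_rfl, hst⟩) (hne t ⟨hst, le_rfl⟩))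
    have hlt : s < t := lt_of_le_of_ne hst (by
      rintro rfl; exact absurd (mul_self_nonneg (φ k s)) hneg'.not_ge)
    obtain ⟨z, hz, hz0⟩ := exists_zero_of_mul_neg hlt ((hcont _ (hφW k)).mono
      (Set.OrdConnected.out ‹_› (by simpa using hs.2 k) (by simpa using ht.2 k))) hneg'
    exact hne z (Set.Ioo_subset_Icc_self hz) hz0
  have hcross : ∀ k s t, IsConfig J (update X k s) → IsConfig J (update X k t) → s < X k →
      X k < t → φ k s * φ k t < 0 := fun k s t hs ht hsk hkt =>
    mul_neg_across_zero hdim hcont hW hWa hX (hφW k) (hφX k) hs ht hsk hkt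
      (hφne k s hs hsk.ne) (hφne k t ht hkt.ne')
  have hsample : ∀ k, ∃ t, IsConfig J (update X k t) ∧ t ≠ X k := by
    intro k
    rcases Nat.eq_zero_or_pos (k : ℕ) with hk | hk
    · have hj : (k : ℕ) + 1 = (⟨k + 1, by omega⟩ : Fin (m + 2)) := rfl
      have := hX.1 (Fin.lt_def.2 (by rw [← hj]; omega) : k < ⟨k + 1, by omega⟩)
      exact ⟨_, (hX.update_midpoint hj).1, by linarith⟩
    · obtain ⟨l, hl⟩ : ∃ l : Fin (m + 2), (l : ℕ) + 1 = k := ⟨⟨k - 1, by omega⟩, by simp; omega⟩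
      have := hX.1 (Fin.lt_def.2 (by omega) : l < k)
      exact ⟨_, (hX.update_midpoint hl).2, by linarith⟩
  have hdir : ∀ k, ∃ e : ℝ, ∀ s, IsConfig J (update X k s) → s ≠ X k →
      0 < e * (s - X k) * φ k s := by
    intro k
    obtain ⟨t, ht, htk⟩ := hsample k
    refine ⟨(t - X k) * φ k t, fun s hs hsk => ?_⟩
    have heq : (t - X k) * φ k t * (s - X k) * φ k s =
        ((t - X k) * (s - X k)) * (φ k s * φ k t) := by ring
    rw [heq]
    rcases htk.lt_or_gt with h1 | h1 <;> rcases hsk.lt_or_gt with h2 | h2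
    · refine mul_pos (mul_pos_of_neg_of_neg (by linarith) (by linarith)) ?_
      rcases le_total s t with h | h
      · exact hside k s t hs ht h (Or.inr h1)
      · rw [mul_comm]; exact hside k t s ht hs h (Or.inr h2)
    · refine mul_pos_of_neg_of_neg (mul_neg_of_neg_of_pos (by linarith) (by linarith)) ?_
      rw [mul_comm]; exact hcross k t s ht hs h1 h2
    · refine mul_pos_of_neg_of_neg (mul_neg_of_pos_of_neg (by linarith) (by linarith)) ?_
      exact hcross k s t hs ht h2 h1
    · refine mul_pos (mul_pos (by linarith) (by linarith)) ?_
      rcases le_total s t with h | h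
      · exact hside k s t hs ht h (Or.inl h2)
      · rw [mul_comm]; exact hside k t s ht hs h (Or.inl h1)
  -- the linear relation between the evaluations at the points of `X` alternates in sign
  obtain ⟨c, hc, hc0⟩ := Matrix.exists_vecMul_eq_zero_iff.2 h0
  have hrel : ∀ j k t, c k * φ j t = c j * φ k t := fun j k t => by
    simp only [hφ, collocationMatrix_update]
    exact Matrix.mul_det_updateRow_comm hc0 j k _
  have hcne : ∀ k, c k ≠ 0 := by
    obtain ⟨i, hi⟩ := Function.ne_iff.1 hc
    intro k hk
    obtain ⟨t, ht, htk⟩ := hsample k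
    have := hrel k i t
    rw [hk, zero_mul] at this
    exact mul_ne_zero hi (hφne k t ht htk) this
  have hcW : ∀ w ∈ W, ∑ i, c i * w (X i) = 0 := by
    intro w hw
    have h1 : ∀ j, ∑ i, c i * (b j : ℝ → ℝ) (X i) = 0 := fun j => congrFun hc0 j
    simp_rw [apply_eq_sum_repr b hw, Finset.mul_sum]
    rw [Finset.sum_comm]
    refine Finset.sum_eq_zero fun j _ => ?_
    have h2 : ∀ i, c i * (b.repr ⟨w, hw⟩ j * (b j : ℝ → ℝ) (X i)) =
        b.repr ⟨w, hw⟩ j * (c i * (b j : ℝ → ℝ) (X i)) := fun i => by ring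
    simp_rw [h2, ← Finset.mul_sum, h1, mul_zero]
  -- so in the gap between two neighbours the functions `φ j` and `φ k` have opposite signs
  have hgap : ∀ j k : Fin (m + 2), (j : ℕ) + 1 = k →
      φ j ((X j + X k) / 2) * φ k ((X j + X k) / 2) < 0 := by
    intro j k hjk
    have hne : j ≠ k := fun h => by rw [h] at hjk; omega
    obtain ⟨h, hh, hhX, hhp⟩ := exists_vanishing_others hdim hcont hWa hX hjk
    have h1 : c j * h (X j) + c k * h (X k) = 0 := by
      rw [← hcW h hh, ← Finset.sum_subset (Finset.subset_univ {j, k}), Finset.sum_pair hne]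
      intro i _ hi
      simp only [Finset.mem_insert, Finset.mem_singleton, not_or] at hi
      rw [hhX i hi.1 hi.2, mul_zero]
    have hck : c j * c k < 0 := by
      have hhk : h (X k) ≠ 0 := fun h => by simp [h] at hhp
      have h2 : c j * c k * (h (X j) * h (X k)) = -(c k * h (X k)) ^ 2 := by
        linear_combination (c k * h (X k)) * h1
      have h3 : 0 < (c k * h (X k)) ^ 2 := by
        have := hcne k
        positivity
      by_contra! h4
      have := mul_nonneg h4 hhp.le
      linarith
    set t := (X j + X k) / 2 with ht
    have hlt : X j < X k := hX.1 (Fin.lt_def.2 (by omega))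
    have h2 := hrel j k t
    have h3 : φ j t ≠ 0 := hφne j t (hX.update_midpoint hjk).1 (by linarith)
    have h4 : c j * c k * (φ j t * φ k t) = (c k * φ j t) ^ 2 := by
      linear_combination -(c k * φ j t) * h2
    have h5 : 0 < (c k * φ j t) ^ 2 := by
      have := hcne k
      positivity
    by_contra! h6
    have := mul_nonpos_of_nonpos_of_nonneg hck.le h6
    linarith
  -- a direction at one point is therefore a direction at the next point
  have hstep : ∀ (e : ℝ) (j k : Fin (m + 2)), (j : ℕ) + 1 = k →
      (∀ s, IsConfig J (update X j s) → s ≠ X j → 0 < e * (s - X j) * φ j s) →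
      ∀ s, IsConfig J (update X k s) → s ≠ X k → 0 < e * (s - X k) * φ k s := by
    intro e j k hjk hj s hs hsk
    obtain ⟨e', he'⟩ := hdir k
    set t := (X j + X k) / 2 with ht
    have hlt : X j < X k := hX.1 (Fin.lt_def.2 (by omega))
    have h1 := hj t (hX.update_midpoint hjk).1 (by linarith)
    have h2 := he' t (hX.update_midpoint hjk).2 (by linarith)
    have h3 := hgap j k hjk
    rw [← ht] at h3
    have h4 : 0 < e * e' := by
      have h5 := mul_pos h1 h2
      have h6 : e * (t - X j) * φ j t * (e' * (t - X k) * φ k t) =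
          (e * e') * (((t - X j) * (t - X k)) * (φ j t * φ k t)) := by ring
      have h7 : 0 < ((t - X j) * (t - X k)) * (φ j t * φ k t) :=
        mul_pos_of_neg_of_neg (mul_neg_of_pos_of_neg (by linarith) (by linarith)) h3
      rw [h6] at h5
      exact pos_of_mul_pos_left h5 h7.le
    have h5 := mul_pos h4 (he' s hs hsk)
    have h6 : e * e' * (e' * (s - X k) * φ k s) = e' ^ 2 * (e * (s - X k) * φ k s) := by ring
    rw [h6] at h5
    exact pos_of_mul_pos_right h5 (sq_nonneg e')
  obtain ⟨e, he⟩ := hdir 0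
  refine ⟨e, fun k => ?_⟩
  obtain ⟨k, hk⟩ := k
  induction k with
  | zero => exact he
  | succ k ih => exact hstep e ⟨k, by omega⟩ ⟨k + 1, hk⟩ rfl (ih (by omega))

end

/-! ### Boundedly many disjoint intervals with too many zeros -/

section
open Function

theorem IsConfig.mono {n : ℕ} {J J' : Set ℝ} {X : Fin n → ℝ} (hX : IsConfig J X) (h : J ⊆ J') :
    IsConfig J' X :=
  ⟨hX.1, fun i => h (hX.2 i)⟩

theorem exists_config_of_not_hasAtMostZeros {W : Submodule ℝ (ℝ → ℝ)} {I : Set ℝ} {m : ℕ}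
    (h : ¬ HasAtMostZeros W I m) :
    ∃ w ∈ W, w ≠ 0 ∧ ∃ X : Fin (m + 1) → ℝ, IsConfig I X ∧ ∀ i, w (X i) = 0 := by
  unfold HasAtMostZeros at h
  push Not at h
  obtain ⟨w, hw, h0, F, hF, hcard⟩ := h
  obtain ⟨G, hGF, hG⟩ := Finset.exists_subset_card_eq (Nat.succ_le_of_lt hcard)
  refine ⟨w, hw, h0, G.orderEmbOfFin hG, ⟨(G.orderEmbOfFin hG).strictMono, fun i => ?_⟩,
    fun i => ?_⟩
  · exact (hF _ (hGF (G.orderEmbOfFin_mem hG i))).1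
  · exact (hF _ (hGF (G.orderEmbOfFin_mem hG i))).2

theorem det_collocationMatrix_eq_zero {W : Submodule ℝ (ℝ → ℝ)} {n : ℕ}
    (b : Module.Basis (Fin n) ℝ W) {X : Fin n → ℝ} {w : ℝ → ℝ} (hw : w ∈ W) (h0 : w ≠ 0)
    (hX : ∀ i, w (X i) = 0) : (collocationMatrix b X).det = 0 := by
  refine Matrix.exists_mulVec_eq_zero_iff.1 ⟨b.repr ⟨w, hw⟩, fun h => h0 ?_, ?_⟩
  · have h1 : b.repr ⟨w, hw⟩ = 0 := Finsupp.ext fun i => congrFun h i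
    simpa using h1
  · ext i
    have := hX i
    rw [apply_eq_sum_repr b hw] at this
    simpa [Matrix.mulVec, dotProduct, collocationMatrix, mul_comm] using this

/-- The intervals `[p i, q i]`, for `i < N`, lie in `I` in this order and are pairwise disjoint, and
each contains more than `m` zeros of some nonzero function of `W`, which may depend on `i`. -/
structure IsBlockSequence (W : Submodule ℝ (ℝ → ℝ)) (I : Set ℝ) (m N : ℕ) (p q : ℕ → ℝ) :
    Prop where
  lt : ∀ i, i + 1 < N → q i < p (i + 1)
  subset : ∀ i < N, Set.Icc (p i) (q i) ⊆ I
  not_hasAtMostZeros : ∀ i < N, ¬ HasAtMostZeros W (Set.Icc (p i) (q i)) m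

variable {W : Submodule ℝ (ℝ → ℝ)} {I J : Set ℝ} {m N : ℕ} {p q : ℕ → ℝ}

theorem IsBlockSequence.le (h : IsBlockSequence W I m N p q) {i : ℕ} (hi : i < N) :
    p i ≤ q i := by
  obtain ⟨-, -, -, X, hX, -⟩ :=
    exists_config_of_not_hasAtMostZeros (h.not_hasAtMostZeros i hi)
  exact (hX.2 0).1.trans (hX.2 0).2

theorem IsBlockSequence.lt_of_lt (h : IsBlockSequence W I m N p q) {i j : ℕ} (hij : i < j)
    (hj : j < N) : q i < p j := by
  induction j, hij using Nat.le_induction with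
  | base => exact h.lt i hj
  | succ j hij ih => exact (ih (by omega)).trans_le ((h.le (by omega)).trans (h.lt j hj).le)

theorem IsBlockSequence.monotone_left (h : IsBlockSequence W I m N p q) {i j : ℕ} (hij : i ≤ j)
    (hj : j < N) : p i ≤ p j := by
  rcases hij.eq_or_lt with rfl | hlt
  · exact le_rfl
  · exact (h.le (hlt.trans hj)).trans (h.lt_of_lt hlt hj).le

theorem IsBlockSequence.monotone_right (h : IsBlockSequence W I m N p q) {i j : ℕ} (hij : i ≤ j)
    (hj : j < N) : q i ≤ q j := by
  rcases hij.eq_or_lt with rfl | hlt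
  · exact le_rfl
  · exact (h.lt_of_lt hlt hj).le.trans (h.le hj)

/-- Near a zero, the collocation determinant takes both weak signs on configurations in `[u, v]`. -/
theorem exists_config_with_sign [J.OrdConnected] {a : ℝ} (b : Module.Basis (Fin (m + 2)) ℝ W)
    (hcont : ∀ w ∈ W, ContinuousOn w J) (hW : HasAtMostZeros W J (m + 2))
    (hWa : HasAtMostZeros (vanishingAt W a) J m) {u v : ℝ} (huv : Set.Icc u v ⊆ J)
    (h : ¬ HasAtMostZeros W (Set.Icc u v) (m + 1)) (P : Prop) :
    ∃ Y, IsConfig (Set.Icc u v) Y ∧ (0 ≤ (collocationMatrix b Y).det ↔ P) := by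
  obtain ⟨w, hw, h0, X, hX, hwX⟩ := exists_config_of_not_hasAtMostZeros h
  have hdet := det_collocationMatrix_eq_zero b hw h0 hwX
  by_cases hP : P
  · exact ⟨X, hX, iff_of_true hdet.ge hP⟩
  obtain ⟨e, he⟩ := (isTransversal_det_collocationMatrix b hcont hW hWa).exists_direction X
    (hX.mono huv) hdet
  have hlt : X 0 < X 1 := hX.1 (by simp)
  obtain ⟨c0, c1⟩ := hX.update_midpoint (j := 0) (k := 1) (by simp)
  have h2 := he 0 _ (c0.mono huv) (by linarith)
  have h3 := he 1 _ (c1.mono huv) (by linarith)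
  by_cases h4 : 0 ≤ (collocationMatrix b (update X 0 ((X 0 + X 1) / 2))).det
  · refine ⟨_, c1, iff_of_false (fun h5 => ?_) hP⟩
    rcases le_total 0 e with h6 | h6
    · have := mul_nonneg (mul_nonneg h6 (by linarith : 0 ≤ X 1 - (X 0 + X 1) / 2)) h5
      linarith
    · have := mul_nonneg (mul_nonneg (neg_nonneg.2 h6) (by linarith : 0 ≤ (X 0 + X 1) / 2 - X 0)) h4
      linarith
  · exact ⟨_, c0, iff_of_false h4 hP⟩

/-- Choosing in each block a configuration so that the weak signs alternate contradicts the bound on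
sign changes along increasing sequences of configurations. -/
theorem not_isBlockSequence_of_vanishingAt [J.OrdConnected] {a : ℝ}
    (hdim : Module.finrank ℝ W = m + 2)
    (hcont : ∀ w ∈ W, ContinuousOn w J) (hW : HasAtMostZeros W J (m + 2))
    (hWa : HasAtMostZeros (vanishingAt W a) J m) :
    ¬ IsBlockSequence W J (m + 1) (m + 4) p q := by
  intro h
  have : FiniteDimensional ℝ W := Module.finite_of_finrank_pos (by omega)
  let b := Module.finBasisOfFinrankEq ℝ W hdim
  have hex : ∀ i, ∃ Y, i < m + 4 → IsConfig (Set.Icc (p i) (q i)) Y ∧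
      (0 ≤ (collocationMatrix b Y).det ↔ Even i) := by
    intro i
    by_cases hi : i < m + 4
    · obtain ⟨Y, hY⟩ := exists_config_with_sign b hcont hW hWa (h.subset i hi)
        (h.not_hasAtMostZeros i hi) (Even i)
      exact ⟨Y, fun _ => hY⟩
    · exact ⟨0, fun hi' => absurd hi' hi⟩
  choose A hA using hex
  have := (isTransversal_det_collocationMatrix b hcont hW hWa).length_le (N := m + 3) (A := A)
    (fun i hi => (hA i (by omega)).1.mono (h.subset i (by omega)))
    (fun i hi j => ((hA i (by omega)).1.2 j).2.trans
      ((h.lt i (by omega)).le.trans ((hA (i + 1) (by omega)).1.2 j).1))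
    (fun i hi => by
      rw [(hA i (by omega)).2, (hA (i + 1) (by omega)).2, Nat.even_add_one]
      tauto)
  omega

theorem finrank_vanishingAt {W : Submodule ℝ (ℝ → ℝ)} {a : ℝ} {w : ℝ → ℝ} (hw : w ∈ W)
    (hwa : w a ≠ 0) (hdim : Module.finrank ℝ W = m + 2) :
    Module.finrank ℝ (vanishingAt W a) = m + 1 := by
  have : FiniteDimensional ℝ W := Module.finite_of_finrank_pos (by omega)
  let φ : W →ₗ[ℝ] ℝ := (LinearMap.proj a).comp W.subtype
  have hφ : Function.Surjective φ := LinearMap.surjective fun h0 => hwa (by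
    have := LinearMap.congr_fun h0 ⟨w, hw⟩
    simpa [φ] using this)
  have h1 := LinearMap.finrank_range_add_finrank_ker φ
  rw [LinearMap.range_eq_top.2 hφ, finrank_top, Module.finrank_self, hdim] at h1
  have h2 : (LinearMap.ker φ).map W.subtype = vanishingAt W a := by
    ext f
    simp only [Submodule.mem_map, mem_vanishingAt]
    constructor
    · rintro ⟨⟨f, hf⟩, hf0, rfl⟩
      exact ⟨hf, by simpa [φ] using hf0⟩
    · rintro ⟨hf, hf0⟩
      exact ⟨⟨f, hf⟩, by simpa [φ] using hf0, rfl⟩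
  rw [← h2, (Submodule.equivMapOfInjective W.subtype W.subtype_injective _).finrank_eq.symm]
  omega

/-- The number of disjoint intervals that carry too many zeros is bounded in terms of the dimension.
The induction passes to the functions vanishing at a point `a` to the left: among
sufficiently many groups of `m + 4` consecutive blocks there is one whose hull is Chebyshev for the
smaller space. -/
theorem exists_forall_not_isBlockSequence (m : ℕ) : ∃ N : ℕ,
    ∀ (W : Submodule ℝ (ℝ → ℝ)) (I : Set ℝ), I.OrdConnected →
      Module.finrank ℝ W = m + 1 → (∀ w ∈ W, ContinuousOn w I) →
      HasAtMostZeros W I (m + 1) → ∀ p q, ¬ IsBlockSequence W I m N p q := by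
  induction m with
  | zero =>
    refine ⟨2, fun W I _ hdim _ hW p q h => ?_⟩
    obtain ⟨f, hf, hf0, X, hX, hfX⟩ :=
      exists_config_of_not_hasAtMostZeros (h.not_hasAtMostZeros 0 (by omega))
    obtain ⟨g, hg, hg0, Y, hY, hgY⟩ :=
      exists_config_of_not_hasAtMostZeros (h.not_hasAtMostZeros 1 (by omega))
    obtain ⟨c, hc⟩ := (finrank_eq_one_iff_of_nonzero' (⟨g, hg⟩ : W) (by simpa using hg0)).1 hdim
      ⟨f, hf⟩
    have hfY : f (Y 0) = 0 := by
      have : c • g = f := congrArg Subtype.val hc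
      rw [← this]; simp [hgY 0]
    have hlt : X 0 < Y 0 := ((hX.2 0).2.trans_lt (h.lt 0 (by omega))).trans_le (hY.2 0).1
    have := hW f hf hf0 {X 0, Y 0} (by
      intro x hx
      rcases Finset.mem_insert.1 hx with rfl | hx
      · exact ⟨h.subset 0 (by omega) (hX.2 0), hfX 0⟩
      · rw [Finset.mem_singleton.1 hx]
        exact ⟨h.subset 1 (by omega) (hY.2 0), hfY⟩)
    rw [Finset.card_pair hlt.ne] at this
    omega
  | succ m ih =>
    obtain ⟨N, hN⟩ := ih
    refine ⟨1 + N * (m + 4), fun W I hI hdim hcont hW p q h => ?_⟩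
    -- a base point in the first block at which not all of `W` vanishes
    obtain ⟨w, hw, hw0, X, hX, hwX⟩ :=
      exists_config_of_not_hasAtMostZeros (h.not_hasAtMostZeros 0 (by omega))
    have hpq : p 0 < q 0 :=
      (hX.2 0).1.trans_lt ((hX.1 (by simp : (0 : Fin (m + 2)) < 1)).trans_le
        (hX.2 1).2)
    obtain ⟨a, ha, hwa⟩ : ∃ a ∈ Set.Icc (p 0) (q 0), w a ≠ 0 := by
      by_contra! hall
      obtain ⟨F, hF, hFc⟩ := (Set.Icc_infinite hpq).exists_subset_card_eq (m + 3)
      have := hW w hw hw0 F fun x hx => ⟨h.subset 0 (by omega) (hF hx), hall x (hF hx)⟩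
      omega
    have haI : a ∈ I := h.subset 0 (by omega) ha
    have hWa : HasAtMostZeros (vanishingAt W a) (I ∩ Set.Ioi a) (m + 1) := by
      intro f hf hf0 F hF
      have haF : a ∉ F := fun haF => lt_irrefl a (hF a haF).1.2
      obtain ⟨hfW, hfa⟩ := mem_vanishingAt.1 hf
      have := hW f hfW hf0 (insert a F) (by
        intro x hx
        rcases Finset.mem_insert.1 hx with rfl | hx
        · exact ⟨haI, hfa⟩
        · exact ⟨(hF x hx).1.1, (hF x hx).2⟩)
      rw [Finset.card_insert_of_notMem haF] at this
      omega
    have hidx : ∀ g < N, g * (m + 4) + (m + 4) ≤ N * (m + 4) := fun g hg => by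
      have := Nat.mul_le_mul_right (m + 4) (Nat.succ_le_of_lt hg)
      rwa [Nat.succ_mul] at this
    refine hN (vanishingAt W a) (I ∩ Set.Ioi a) (hI.inter Set.ordConnected_Ioi)
      (finrank_vanishingAt hw hwa hdim)
      (fun f hf => (hcont f (mem_vanishingAt.1 hf).1).mono Set.inter_subset_left) hWa
      (fun g => p (1 + g * (m + 4))) (fun g => q (1 + g * (m + 4) + (m + 3))) ⟨?_, ?_, ?_⟩
    · intro g hg
      have := hidx _ hg
      exact h.lt_of_lt (by rw [Nat.succ_mul]; omega) (by omega)
    · intro g hg x hx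
      have := hidx _ hg
      have h1 : p (1 + g * (m + 4)) ∈ I := h.subset _ (by omega) ⟨le_rfl, h.le (by omega)⟩
      have h2 : q (1 + g * (m + 4) + (m + 3)) ∈ I :=
        h.subset _ (by omega) ⟨h.le (by omega), le_rfl⟩
      refine ⟨hI.out h1 h2 hx, ha.2.trans_lt ((h.lt_of_lt ?_ ?_).trans_le hx.1)⟩ <;> omega
    · intro g hg hgood
      have hg' := hidx _ hg
      have hsub : Set.Icc (p (1 + g * (m + 4))) (q (1 + g * (m + 4) + (m + 3))) ⊆ I :=
        hI.out (h.subset _ (by omega) ⟨le_rfl, h.le (by omega)⟩)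
          (h.subset _ (by omega) ⟨h.le (by omega), le_rfl⟩)
      refine not_isBlockSequence_of_vanishingAt hdim (fun f hf => (hcont f hf).mono hsub)
        (hW.mono le_rfl hsub) hgood (p := fun i => p (1 + g * (m + 4) + i))
        (q := fun i => q (1 + g * (m + 4) + i)) ⟨?_, ?_, ?_⟩
      · intro i hi
        exact h.lt_of_lt (by omega) (by omega)
      · intro i hi
        exact Set.Icc_subset_Icc (h.monotone_left (by omega) (by omega))
          (h.monotone_right (by omega) (by omega))
      · intro i hi
        exact h.not_hasAtMostZeros _ (by omega)

end

/-! ### From bounded block sequences to a subdivision -/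

section
open Function

/-- `[p, q]` is divided into `k` consecutive, possibly degenerate, intervals whose end points
satisfy `P`. -/
def Subdivides (P : ℝ → ℝ → Prop) : ℕ → ℝ → ℝ → Prop
  | 0, p, q => p = q
  | k + 1, p, q => ∃ r, p ≤ r ∧ P p r ∧ Subdivides P k r q

theorem Subdivides.exists_fin {P : ℝ → ℝ → Prop} {k : ℕ} {p q : ℝ} (h : Subdivides P k p q) :
    ∃ c : Fin (k + 1) → ℝ, Monotone c ∧ c 0 = p ∧ c (Fin.last k) = q ∧
      ∀ i : Fin k, P (c i.castSucc) (c i.succ) := by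
  induction k generalizing p with
  | zero => exact ⟨fun _ => p, fun _ _ _ => le_rfl, rfl, h, fun i => i.elim0⟩
  | succ k ih =>
    obtain ⟨r, hpr, hP, hr⟩ := h
    obtain ⟨c, hc, h0, hl, hcP⟩ := ih hr
    have hstep : ∀ i : Fin (k + 1),
        (Fin.cons p c : Fin (k + 2) → ℝ) i.castSucc ≤ (Fin.cons p c : Fin (k + 2) → ℝ) i.succ ∧
          P ((Fin.cons p c : Fin (k + 2) → ℝ) i.castSucc)
            ((Fin.cons p c : Fin (k + 2) → ℝ) i.succ) := by
      intro i
      refine Fin.cases ?_ (fun i => ?_) i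
      · simpa [h0] using ⟨hpr, hP⟩
      · simpa [← Fin.succ_castSucc] using ⟨hc (Fin.castSucc_le_succ i), hcP i⟩
    refine ⟨Fin.cons p c, Fin.monotone_iff_le_succ.2 fun i => (hstep i).1, rfl, ?_,
      fun i => (hstep i).2⟩
    rw [← Fin.succ_last, Fin.cons_succ, hl]

theorem Subdivides.refine_two {P Q : ℝ → ℝ → Prop}
    (hPQ : ∀ p q, P p q → ∃ r, p ≤ r ∧ r ≤ q ∧ Q p r ∧ Q r q) {k : ℕ} {p q : ℝ}
    (h : Subdivides P k p q) : Subdivides Q (2 * k) p q := by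
  induction k generalizing p with
  | zero => exact h
  | succ k ih =>
    obtain ⟨r, -, hP, hr⟩ := h
    obtain ⟨s, hps, hsr, h1, h2⟩ := hPQ _ _ hP
    exact ⟨s, hps, h1, r, hsr, h2, ih hr⟩

variable {W : Submodule ℝ (ℝ → ℝ)} {d : ℕ}

/-- Cutting greedily at the largest possible points gives at most `N` open intervals on which
functions of `W` have at most `d` zeros. The pieces are open because the supremum that defines a
cut need not be attained for closed intervals. -/
theorem exists_subdivides_Ioo {a b : ℝ} (N : ℕ) {p q : ℝ} (hap : a ≤ p) (hpq : p ≤ q) (hqb : q ≤ b)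
    (hN : ∀ P Q, ¬ IsBlockSequence W (Set.Ioo p q) d N P Q) :
    ∃ k ≤ N, Subdivides (fun u v => a ≤ u ∧ u ≤ v ∧ v ≤ b ∧ HasAtMostZeros W (Set.Ioo u v) d)
      k p q := by
  induction N generalizing p with
  | zero => exact absurd ⟨by omega, by omega, by omega⟩ (hN 0 0)
  | succ N ih =>
    -- the longest initial piece on which the zero count holds
    set S := {s | s ∈ Set.Icc p q ∧ HasAtMostZeros W (Set.Ioo p s) d} with hS
    have hpS : p ∈ S := ⟨⟨le_rfl, hpq⟩, fun w _ _ F hF => by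
      have : F = ∅ := Finset.eq_empty_of_forall_notMem fun x hx => by simpa using (hF x hx).1
      simp [this]⟩
    have hbdd : BddAbove S := ⟨q, fun s hs => hs.1.2⟩
    have hpc : p ≤ sSup S := le_csSup hbdd hpS
    have hcq : sSup S ≤ q := csSup_le ⟨p, hpS⟩ fun s hs => hs.1.2
    set c := sSup S with hc
    have hgood : HasAtMostZeros W (Set.Ioo p c) d := by
      intro w hw hw0 F hF
      rcases F.eq_empty_or_nonempty with rfl | hne
      · simp
      obtain ⟨s, hs, hFs⟩ := exists_lt_of_lt_csSup ⟨p, hpS⟩ (hF _ (F.max'_mem hne)).1.2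
      exact hs.2 w hw hw0 F fun x hx => ⟨⟨(hF x hx).1.1, (F.le_max' x hx).trans_lt hFs⟩, (hF x hx).2⟩
    rcases hcq.eq_or_lt with hcq' | hcq'
    · exact ⟨1, by omega, q, hpq, ⟨hap, hpq, hqb, hcq' ▸ hgood⟩, rfl⟩
    -- `(p, s)` contains a block for every `s > c`, which leaves fewer blocks for `(c, q)`
    obtain ⟨k, hk, hsub⟩ := ih (p := c) (hap.trans hpc) hcq fun P Q h => by
      obtain ⟨s, hcs, hsq, hsP⟩ : ∃ s, c < s ∧ s ≤ q ∧ (0 < N → s ≤ P 0) := by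
        rcases Nat.eq_zero_or_pos N with h0 | h0
        · exact ⟨q, hcq', le_rfl, by omega⟩
        · have := h.subset 0 h0 ⟨le_rfl, h.le h0⟩
          exact ⟨P 0, this.1, this.2.le, fun _ => le_rfl⟩
      have hbad : ¬ HasAtMostZeros W (Set.Ioo p s) d := fun hs =>
        (le_csSup hbdd ⟨⟨hpc.trans hcs.le, hsq⟩, hs⟩).not_gt hcs
      obtain ⟨w, hw, hw0, X, hX, hwX⟩ := exists_config_of_not_hasAtMostZeros hbad
      refine hN (fun i => if i = 0 then X 0 else P (i - 1))
        (fun i => if i = 0 then X (Fin.last d) else Q (i - 1)) ⟨?_, ?_, ?_⟩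
      · rintro (_ | i) hi
        · simpa using (hX.2 (Fin.last d)).2.trans_le (hsP (by omega))
        · simpa using h.lt i (by omega)
      · rintro (_ | i) hi x hx
        · simp only [if_true] at hx
          exact ⟨(hX.2 0).1.trans_le hx.1, (hx.2.trans_lt (hX.2 _).2).trans_le hsq⟩
        · simp only [Nat.succ_ne_zero, if_false, Nat.add_sub_cancel] at hx
          have := h.subset i (by omega) hx
          exact ⟨hpc.trans_lt this.1, this.2⟩
      · rintro (_ | i) hi hcon
        · simp only [if_true] at hcon
          have := hcon.le_of_injective hw hw0 hX.1.injective
            (fun i => ⟨hX.1.monotone (Fin.zero_le i), hX.1.monotone (Fin.le_last i)⟩) hwX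
          omega
        · exact h.not_hasAtMostZeros i (by omega) (by simpa using hcon)
    exact ⟨k + 1, by omega, c, hpc, ⟨hap, hpc, hcq.trans hqb, hgood⟩, hsub⟩

/-- In a Chebyshev space of dimension `d + 1` on an open interval, a function with `d` zeros changes
sign at each of them. -/
theorem mul_neg_across_zero_of_card_eq {p q : ℝ} (hdim : Module.finrank ℝ W = d + 1)
    (hcont : ∀ w ∈ W, ContinuousOn w (Set.Ioo p q)) (hW : HasAtMostZeros W (Set.Ioo p q) d)
    {w : ℝ → ℝ} (hw : w ∈ W) (hw0 : w ≠ 0) {T : Finset ℝ} (hT : T.card = d)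
    (hTw : ∀ x ∈ T, x ∈ Set.Ioo p q ∧ w x = 0) {t y z : ℝ} (ht : t ∈ T) (hpy : p < y) (hyt : y < t)
    (htz : t < z) (hzq : z < q) (hTyz : ∀ x ∈ T, x = t ∨ x < y ∨ z < x) : w y * w z < 0 := by
  have hyI : y ∈ Set.Ioo p q := ⟨hpy, by linarith⟩
  have hzI : z ∈ Set.Ioo p q := ⟨by linarith, hzq⟩
  have hne : ∀ x ∈ Set.Ioo p q, x ∉ T → w x ≠ 0 := by
    intro x hx hxT hwx
    have := hW w hw hw0 (insert x T) (by
      intro u hu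
      rcases Finset.mem_insert.1 hu with rfl | hu
      · exact ⟨hx, hwx⟩
      · exact hTw u hu)
    rw [Finset.card_insert_of_notMem hxT] at this
    omega
  have hyT : y ∉ T := fun h => by rcases hTyz y h with h | h | h <;> linarith
  have hzT : z ∉ T := fun h => by rcases hTyz z h with h | h | h <;> linarith
  have hwy := hne y hyI hyT
  have hwz := hne z hzI hzT
  by_contra! hneg
  have hpos : 0 < w y * w z := lt_of_le_of_ne hneg (mul_ne_zero hwy hwz).symm
  have hd : 0 < d := by rw [← hT]; exact Finset.card_pos.2 ⟨t, ht⟩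
  have hR : (T.erase t).card = d - 1 := by rw [Finset.card_erase_of_mem ht, hT]
  obtain ⟨h, hh, hh0, hhz⟩ := exists_vanishing (W := W) (F := insert y (T.erase t))
    ((Finset.card_insert_le _ _).trans_lt (by omega))
  have hht : h t ≠ 0 := by
    intro hht
    have := hW h hh hh0 (insert y T) (by
      intro u hu
      rcases Finset.mem_insert.1 hu with rfl | hu
      · exact ⟨hyI, hhz _ (Finset.mem_insert_self _ _)⟩
      · refine ⟨(hTw u hu).1, ?_⟩
        rcases eq_or_ne u t with rfl | hut
        · exact hht
        · exact hhz _ (Finset.mem_insert_of_mem (Finset.mem_erase.2 ⟨hut, hu⟩)))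
    rw [Finset.card_insert_of_notMem hyT] at this
    omega
  have hsq : 0 < (w y * h t) ^ 2 := by positivity
  obtain ⟨ε, hε, hs⟩ := exists_perturbation (σ := ![w y, -w y, w y]) (f := ![w y, w t, w z])
    (h := ![0, -(w y * h t) * h t, -(w y * h t) * h z]) (by
      intro i
      fin_cases i
      · left; simpa using mul_self_pos.2 hwy
      · right
        refine ⟨(hTw t ht).2, ?_⟩
        simp
        nlinarith
      · left; simpa using hpos)
  set F := w + ε • (-(w y * h t)) • h with hF
  have hFW : F ∈ W := W.add_mem hw (W.smul_mem _ (W.smul_mem _ hh))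
  have hhy : h y = 0 := hhz _ (Finset.mem_insert_self _ _)
  have hFy : 0 < w y * F y := by simpa [hF, hhy] using hs 0
  have hFt : 0 < -w y * F t := by simpa [hF] using hs 1
  have hFz : 0 < w y * F z := by simpa [hF] using hs 2
  obtain ⟨Z, hZ, hZ'⟩ := exists_zeros_of_alternating (F := F) (w y)
    (fun i => if i = 0 then y else if i = 1 then t else z) 2
    (fun i hi => by interval_cases i <;> simpa)
    ((hcont F hFW).mono (by simpa using Set.Icc_subset_Ioo hpy hzq))
    (fun i hi => by
      interval_cases i
      · simpa using hFy
      · simpa using hFt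
      · simpa using hFz)
  simp only [if_true, if_false, OfNat.ofNat_ne_zero, OfNat.ofNat_ne_one] at hZ'
  have hdisj : Disjoint (T.erase t) Z := Finset.disjoint_left.2 fun u huT huZ => by
    obtain ⟨h1, h2⟩ := Finset.mem_erase.1 huT
    have h3 := (hZ' u huZ).1
    rcases hTyz u h2 with h | h | h
    · exact h1 h
    · exact absurd h3.1 h.not_gt
    · exact absurd h3.2 h.not_gt
  have hF0 : F ≠ 0 := fun h0 => by rw [h0] at hFy; simp at hFy
  have := hW F hFW hF0 (T.erase t ∪ Z) (by
    intro u hu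
    rcases Finset.mem_union.1 hu with hu | hu
    · have h1 := hTw u (Finset.mem_of_mem_erase hu)
      exact ⟨h1.1, by simp [hF, h1.2, hhz u (Finset.mem_insert_of_mem hu)]⟩
    · exact ⟨⟨hpy.trans (hZ' u hu).1.1, (hZ' u hu).1.2.trans hzq⟩, (hZ' u hu).2⟩)
  rw [Finset.card_union_of_disjoint hdisj] at this
  omega

/-- The Chebyshev property passes from an open interval to a closed interval that contains the left
end point and stays away from the right one. A function with a zero at `p` and `d` zeros to the
right of it could be perturbed to have `d + 1` zeros in the open interval. -/
theorem HasAtMostZeros.Icc_left {p q r : ℝ} (hdim : Module.finrank ℝ W = d + 1)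
    (hcont : ∀ w ∈ W, ContinuousOn w (Set.Ico p q)) (hW : HasAtMostZeros W (Set.Ioo p q) d)
    {h : ℝ → ℝ} (hh : h ∈ W) (hhp : h p ≠ 0) (hrq : r < q) :
    HasAtMostZeros W (Set.Icc p r) d := by
  by_contra hcon
  obtain ⟨w, hw, hw0, X, hX, hwX⟩ := exists_config_of_not_hasAtMostZeros hcon
  have hX0 : X 0 = p := by
    by_contra hX0
    have hlt : p < X 0 := lt_of_le_of_ne (hX.2 0).1 (Ne.symm hX0)
    have := hW.le_of_injective hw hw0 hX.1.injective (fun i =>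
      ⟨hlt.trans_le (hX.1.monotone (Fin.zero_le i)), (hX.2 i).2.trans_lt hrq⟩) hwX
    omega
  -- the zeros of `w`, followed by `q`
  set Y : ℕ → ℝ := fun i => if hi : i < d + 1 then X ⟨i, hi⟩ else q with hY
  have hYX : ∀ i (hi : i < d + 1), Y i = X ⟨i, hi⟩ := fun i hi => dif_pos hi
  have hYlt : ∀ i < d + 1, Y i < Y (i + 1) := by
    intro i hi
    rw [hYX i hi]
    by_cases hi' : i + 1 < d + 1
    · rw [hYX _ hi']
      exact hX.1 (Fin.lt_def.2 (Nat.lt_succ_self i))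
    · simp only [hY, hi', dif_neg, not_false_eq_true]
      exact (hX.2 _).2.trans_lt hrq
  have hY0 : Y 0 = p := by rw [hYX 0 (by omega)]; exact hX0
  have hYq : Y (d + 1) = q := by simp [hY]
  have hYmono : ∀ i j, i < j → j ≤ d + 1 → Y i < Y j := by
    intro i j hij
    induction j, hij using Nat.le_induction with
    | base => exact fun hj => hYlt i (by omega)
    | succ j hij ih => exact fun hj => (ih (by omega)).trans (hYlt j (by omega))
  have hYle : ∀ i j, i ≤ j → j ≤ d + 1 → Y i ≤ Y j := fun i j hij hj => by
    rcases hij.eq_or_lt with rfl | hlt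
    · exact le_rfl
    · exact (hYmono i j hlt hj).le
  set y : ℕ → ℝ := fun i => (Y i + Y (i + 1)) / 2 with hy
  have hyl : ∀ i < d + 1, Y i < y i := fun i hi => by
    have := hYlt i hi
    simp only [hy]; linarith
  have hyr : ∀ i < d + 1, y i < Y (i + 1) := fun i hi => by
    have := hYlt i hi
    simp only [hy]; linarith
  -- every zero of `w` in the interior is a sign change
  have hcross : ∀ i < d, w (y i) * w (y (i + 1)) < 0 := by
    intro i hi
    refine mul_neg_across_zero_of_card_eq hdim
      (fun f hf => (hcont f hf).mono Set.Ioo_subset_Ico_self) hW hw hw0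
      (T := Finset.univ.image (X ∘ Fin.succ)) (t := Y (i + 1)) ?_ ?_ ?_ ?_ (hyr i (by omega))
      (hyl _ (by omega)) ?_ ?_
    · rw [Finset.card_image_of_injective _ (hX.1.injective.comp (Fin.succ_injective d))]
      simp
    · intro x hx
      obtain ⟨j, -, rfl⟩ := Finset.mem_image.1 hx
      exact ⟨⟨hX0 ▸ hX.1 (Fin.succ_pos j), (hX.2 _).2.trans_lt hrq⟩, hwX _⟩
    · exact Finset.mem_image.2 ⟨⟨i, hi⟩, Finset.mem_univ _, (hYX (i + 1) (by omega)).symm⟩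
    · exact hY0 ▸ (hYle 0 i (by omega) (by omega)).trans_lt (hyl i (by omega))
    · exact ((hyr (i + 1) (by omega)).trans_le (hYle _ _ (by omega) le_rfl)).trans_eq hYq
    · intro x hx
      obtain ⟨j, -, rfl⟩ := Finset.mem_image.1 hx
      have hj : (X ∘ Fin.succ) j = Y (j + 1) := (hYX (j + 1) (by omega)).symm
      rw [hj]
      rcases lt_trichotomy (j : ℕ) i with hji | hji | hji
      · exact Or.inr (Or.inl ((hYle _ i (by omega) (by omega)).trans_lt (hyl i (by omega))))
      · left; rw [hji]
      · exact Or.inr (Or.inr ((hyr (i + 1) (by omega)).trans_le (hYle _ _ (by omega) (by omega))))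
  have hpy : p < y 0 := hY0 ▸ hyl 0 (by omega)
  have hy0q : y 0 < q := (hyr 0 (by omega)).trans_le (hYq ▸ hYle _ _ (by omega) le_rfl)
  have hwy0 : w (y 0) ≠ 0 := by
    intro hwy
    have := hW.le_of_injective hw hw0 (Y := (Fin.cons (y 0) (X ∘ Fin.succ) : Fin (d + 1) → ℝ))
      (Fin.cons_injective_iff.2 ⟨?_, hX.1.injective.comp (Fin.succ_injective d)⟩)
      (by
        intro i
        refine Fin.cases ?_ (fun i => ?_) i
        · exact ⟨hpy, hy0q⟩
        · exact ⟨hX0 ▸ hX.1 (Fin.succ_pos i), (hX.2 _).2.trans_lt hrq⟩)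
      (by
        intro i
        refine Fin.cases ?_ (fun i => ?_) i
        · exact hwy
        · exact hwX _)
    · omega
    · rintro ⟨j, hj⟩
      have h1 : (X ∘ Fin.succ) j = Y (j + 1) := (hYX (j + 1) (by omega)).symm
      have h2 := (hyr 0 (by omega)).trans_le (hYle 1 (j + 1) (by omega) (by omega))
      rw [← h1, hj] at h2
      exact lt_irrefl _ h2
  have halt : ∀ i ≤ d, 0 < w (y 0) * (-1) ^ i * w (y i) := by
    intro i
    induction i with
    | zero => intro _; simpa using mul_self_pos.2 hwy0
    | succ i ih =>
      intro hi
      have h1 := ih (by omega)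
      have h2 := hcross i (by omega)
      have h3 : w (y 0) * (-1) ^ (i + 1) * w (y (i + 1)) * w (y i) ^ 2 =
          (w (y 0) * (-1) ^ i * w (y i)) * -(w (y i) * w (y (i + 1))) := by ring
      have h4 := mul_pos h1 (neg_pos.2 h2)
      rw [← h3] at h4
      exact pos_of_mul_pos_left h4 (sq_nonneg _)
  -- pushing `w` across zero at `p` creates one more interior zero
  set x : ℕ → ℝ := fun i => if i = 0 then p else y (i - 1) with hx
  have hx0 : x 0 = p := rfl
  have hxs : ∀ i, x (i + 1) = y i := fun i => by simp [hx]
  set g := -(w (y 0) * h p) • h with hg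
  have hgW : g ∈ W := W.smul_mem _ hh
  have hsq : 0 < (w (y 0) * h p) ^ 2 := by positivity
  obtain ⟨ε, hε, hs⟩ := exists_perturbation
    (σ := fun i : Fin (d + 2) => -w (y 0) * (-1) ^ (i : ℕ)) (f := fun i => w (x i))
    (h := fun i => g (x i)) (by
      intro i
      refine Fin.cases ?_ (fun i => ?_) i
      · right
        refine ⟨?_, ?_⟩
        · have := hwX 0
          rw [hX0] at this
          simpa [hx0] using this
        · simp [hx0, hg]
          nlinarith
      · left
        have := halt i (by omega)
        simp only [Fin.val_succ, hxs]
        rw [pow_succ]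
        linarith)
  have hFW : w + ε • g ∈ W := W.add_mem hw (W.smul_mem _ hgW)
  have hF0 : w + ε • g ≠ 0 := fun h0 => by
    have h1 := hs 0
    have h2 := congrFun h0 (x (0 : Fin (d + 2)).val)
    simp only [Pi.add_apply, Pi.smul_apply, smul_eq_mul, Pi.zero_apply] at h2
    rw [h2, mul_zero] at h1
    exact lt_irrefl _ h1
  have hxq : x (d + 1) < q := by
    rw [hxs]; exact (hyr d (by omega)).trans_eq hYq
  obtain ⟨Z, hZ, hZ'⟩ := exists_zeros_of_alternating (F := w + ε • g) (-w (y 0)) x (d + 1)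
    (by
      rintro (_ | i) hi
      · rw [hxs, hx0]; exact hpy
      · rw [hxs, hxs]; exact (hyr i (by omega)).trans (hyl _ (by omega)))
    ((hcont _ hFW).mono (fun u hu => ⟨hu.1, hu.2.trans_lt hxq⟩))
    (fun i hi => by simpa using hs ⟨i, by omega⟩)
  have := hW _ hFW hF0 Z fun u hu =>
    ⟨⟨(hZ' u hu).1.1, (hZ' u hu).1.2.trans hxq⟩, (hZ' u hu).2⟩
  omega

/-- The space of the functions `x ↦ w (-x)` with `w ∈ W`. -/
def reflect (W : Submodule ℝ (ℝ → ℝ)) : Submodule ℝ (ℝ → ℝ) :=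
  W.map (LinearEquiv.funCongrLeft ℝ ℝ (Equiv.neg ℝ)).toLinearMap

theorem mem_reflect {W : Submodule ℝ (ℝ → ℝ)} {f : ℝ → ℝ} :
    f ∈ reflect W ↔ (fun x => f (-x)) ∈ W := by
  unfold reflect
  constructor
  · rintro ⟨g, hg, rfl⟩
    have h : (fun x => (LinearEquiv.funCongrLeft ℝ ℝ (Equiv.neg ℝ)).toLinearMap g (-x)) = g := by
      ext x
      simp [LinearEquiv.funCongrLeft_apply, LinearMap.funLeft]
    rw [h]
    exact hg
  · intro h
    refine ⟨_, h, ?_⟩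
    ext x
    simp [LinearEquiv.funCongrLeft_apply, LinearMap.funLeft]

theorem HasAtMostZeros.reflect {I I' : Set ℝ} {m : ℕ} (hW : HasAtMostZeros W I m)
    (hI : ∀ x ∈ I', -x ∈ I) : HasAtMostZeros (reflect W) I' m := by
  intro f hf hf0 F hF
  rw [← Finset.card_image_of_injective F neg_injective]
  refine hW _ (mem_reflect.1 hf) (fun h => hf0 (funext fun x => ?_)) _ fun x hx => ?_
  · simpa using congrFun h (-x)
  · obtain ⟨y, hy, rfl⟩ := Finset.mem_image.1 hx
    exact ⟨hI y (hF y hy).1, by simpa using (hF y hy).2⟩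

theorem reflect_reflect (W : Submodule ℝ (ℝ → ℝ)) : _root_.reflect (_root_.reflect W) = W := by
  ext f
  simp [mem_reflect]

theorem HasAtMostZeros.Icc_right {p q r : ℝ} (hdim : Module.finrank ℝ W = d + 1)
    (hcont : ∀ w ∈ W, ContinuousOn w (Set.Ioc p q)) (hW : HasAtMostZeros W (Set.Ioo p q) d)
    {h : ℝ → ℝ} (hh : h ∈ W) (hhq : h q ≠ 0) (hpr : p < r) :
    HasAtMostZeros W (Set.Icc r q) d := by
  have key : HasAtMostZeros (_root_.reflect W) (Set.Icc (-q) (-r)) d := by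
    refine HasAtMostZeros.Icc_left (q := -p) (h := fun x => h (-x)) ?_ ?_ ?_ ?_ ?_ ?_
    · rw [← hdim]
      exact LinearEquiv.finrank_map_eq _ W
    · intro w hw
      have h1 := (hcont _ (mem_reflect.1 hw)).comp (continuousOn_neg (s := Set.Ico (-q) (-p)))
        (fun x hx => ⟨by linarith [hx.2], by linarith [hx.1]⟩)
      simpa [Function.comp_def] using h1
    · exact hW.reflect fun x hx => ⟨by linarith [hx.2], by linarith [hx.1]⟩
    · exact mem_reflect.2 (by simpa using hh)
    · simpa using hhq
    · linarith
  rw [← reflect_reflect W]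
  exact key.reflect fun x hx => ⟨by linarith [hx.2], by linarith [hx.1]⟩

end

/-! ### Spaces of functions attached to curves -/

/-- The restriction of affine functions to the curve: `(u, c)` is sent to `t ↦ ⟪u, γ t⟫ - c`, whose
zeros are the intersections of `γ` with the hyperplane `⟪u, x⟫ = c`. -/
noncomputable def affineAlong {d : ℕ} (γ : ℝ → EuclideanSpace ℝ (Fin d)) :
    EuclideanSpace ℝ (Fin d) × ℝ →ₗ[ℝ] (ℝ → ℝ) where
  toFun v := fun t => inner ℝ v.1 (γ t) - v.2
  map_add' u v := by ext t; simp [inner_add_left]; ring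
  map_smul' r v := by ext t; simp [inner_smul_left]; ring

section
variable {d : ℕ} {γ : ℝ → EuclideanSpace ℝ (Fin d)} {a b : ℝ}

theorem continuousOn_of_mem_range_affineAlong {s : Set ℝ} (hγ : ContinuousOn γ s) {w : ℝ → ℝ}
    (hw : w ∈ LinearMap.range (affineAlong γ)) : ContinuousOn w s := by
  obtain ⟨v, rfl⟩ := hw
  exact (continuousOn_const.inner hγ).sub continuousOn_const

theorem card_le_of_isCrossingOn {k : ℕ} (h : IsCrossingOn k γ a b)
    {v : EuclideanSpace ℝ (Fin d) × ℝ} (hv : v ≠ 0) {F : Finset ℝ}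
    (hF : ∀ x ∈ F, x ∈ Set.Icc a b ∧ affineAlong γ v x = 0) : F.card ≤ k := by
  by_cases hu : v.1 = 0
  · have hc : v.2 ≠ 0 := fun hc => hv (Prod.ext hu hc)
    have : F = ∅ := Finset.eq_empty_of_forall_notMem fun x hx => by
      have := (hF x hx).2
      simp [affineAlong, hu, hc] at this
    simp [this]
  · have h1 := h.encard_le {x | inner ℝ v.1 x = v.2} ⟨v.1, v.2, hu, rfl⟩
    have h2 : (F : Set ℝ) ⊆ {t | t ∈ Set.Icc a b ∧ γ t ∈ {x | inner ℝ v.1 x = v.2}} :=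
      fun x hx => ⟨(hF x hx).1, sub_eq_zero.1 (hF x hx).2⟩
    have h3 := (Set.encard_le_encard h2).trans h1
    rw [Set.encard_coe_eq_coe_finsetCard] at h3
    exact_mod_cast h3

theorem affineAlong_injective {k : ℕ} (h : IsCrossingOn k γ a b) (hab : a < b) :
    Function.Injective (affineAlong γ) := by
  rw [← LinearMap.ker_eq_bot, LinearMap.ker_eq_bot']
  intro v hv
  by_contra hv0
  obtain ⟨F, hF, hFc⟩ := (Set.Icc_infinite hab).exists_subset_card_eq (k + 1)
  have := card_le_of_isCrossingOn h hv0 (F := F) fun x hx => ⟨hF hx, congrFun hv x⟩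
  omega

theorem isConvexCurveOn_of_hasAtMostZeros (hab : a ≤ b) (hγ : ContinuousOn γ (Set.Icc a b))
    (hinj : Function.Injective (affineAlong γ))
    (h : HasAtMostZeros (LinearMap.range (affineAlong γ)) (Set.Icc a b) d) :
    IsConvexCurveOn γ a b := by
  refine ⟨⟨hab, hγ⟩, ?_⟩
  rintro H ⟨u, c, hu, rfl⟩
  by_contra! hlt
  obtain ⟨T, hTs, hT⟩ := Set.exists_subset_encard_eq (Order.add_one_le_of_lt hlt)
  have hfin : T.Finite := Set.finite_of_encard_eq_coe (k := d + 1) (by exact_mod_cast hT)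
  have hne : affineAlong γ (u, c) ≠ 0 := fun h0 => by
    have := hinj (h0.trans (map_zero _).symm)
    exact hu (congrArg Prod.fst this)
  have := h _ ⟨(u, c), rfl⟩ hne hfin.toFinset fun x hx => by
    have := hTs (hfin.mem_toFinset.1 hx)
    exact ⟨this.1, sub_eq_zero.2 this.2⟩
  have h2 : (hfin.toFinset.card : ℕ∞) = d + 1 := by
    rw [← hT, hfin.encard_eq_coe_toFinset_card]
  have h3 : hfin.toFinset.card = d + 1 := by exact_mod_cast h2
  omega

theorem hasAtMostZeros_Icc_self {W : Submodule ℝ (ℝ → ℝ)} (hd : 1 ≤ d) (p : ℝ) :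
    HasAtMostZeros W (Set.Icc p p) d := fun w _ _ F hF => by
  refine (Finset.card_le_one.2 fun x hx y hy => ?_).trans hd
  have h1 := (hF x hx).1
  have h2 := (hF y hy).1
  rw [Set.Icc_self] at h1 h2
  rw [h1, h2]

end

theorem theorem1 :
    ∀ d : ℕ, 2 ≤ d → ∃ M : ℕ,
      ∀ (a b : ℝ) (γ : ℝ → EuclideanSpace ℝ (Fin d)), IsCrossingOn (d + 1) γ a b →
        ∃ (k : ℕ) (c : Fin (k + 1) → ℝ),
          1 ≤ k ∧ k ≤ M ∧ Monotone c ∧ c 0 = a ∧ c (Fin.last k) = b ∧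
            ∀ i : Fin k, IsConvexCurveOn γ (c i.castSucc) (c i.succ) := by
  intro d hd
  obtain ⟨N, hN⟩ := exists_forall_not_isBlockSequence d
  refine ⟨2 * N + 1, fun a b γ h => ?_⟩
  rcases h.le.eq_or_lt with rfl | hab
  · refine ⟨1, fun _ => a, le_rfl, by omega, fun _ _ _ => le_rfl, rfl, rfl, fun _ => ?_⟩
    refine ⟨h.toIsCurveOn, fun H _ => ?_⟩
    refine (Set.encard_le_one_iff.2 fun s t hs ht => ?_).trans (by exact_mod_cast (by omega))
    have h1 := hs.1
    have h2 := ht.1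
    rw [Set.Icc_self] at h1 h2
    rw [h1, h2]
  have hinj := affineAlong_injective h hab
  set W := LinearMap.range (affineAlong γ) with hW
  have hdim : Module.finrank ℝ W = d + 1 := by
    rw [hW, LinearMap.finrank_range_of_inj hinj]
    simp
  have hone : (fun _ => -1 : ℝ → ℝ) ∈ W := ⟨(0, 1), by ext t; simp [affineAlong]⟩
  have hcont : ∀ w ∈ W, ContinuousOn w (Set.Icc a b) := fun w hw =>
    continuousOn_of_mem_range_affineAlong h.continuousOn hw
  have hzeros : HasAtMostZeros W (Set.Icc a b) (d + 1) := by
    rintro w ⟨v, rfl⟩ hw0 F hF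
    exact card_le_of_isCrossingOn h (fun hv => hw0 (by rw [hv, map_zero])) hF
  obtain ⟨k, hk, hsub⟩ := exists_subdivides_Ioo (W := W) (d := d) N le_rfl hab.le le_rfl
    fun P Q hPQ => hN W (Set.Icc a b) Set.ordConnected_Icc hdim hcont hzeros P Q
      ⟨hPQ.lt, fun i hi => (hPQ.subset i hi).trans Set.Ioo_subset_Icc_self,
        hPQ.not_hasAtMostZeros⟩
  have hsub2 : Subdivides (IsConvexCurveOn γ) (2 * k) a b := by
    refine hsub.refine_two ?_
    rintro p q ⟨hap, hpq, hqb, hgood⟩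
    have hsubset : Set.Icc p q ⊆ Set.Icc a b := Set.Icc_subset_Icc hap hqb
    have hconv : ∀ u v, p ≤ u → u ≤ v → v ≤ q → HasAtMostZeros W (Set.Icc u v) d →
        IsConvexCurveOn γ u v := fun u v hpu huv hvq huvd =>
      isConvexCurveOn_of_hasAtMostZeros huv
        (h.continuousOn.mono ((Set.Icc_subset_Icc hpu hvq).trans hsubset)) hinj huvd
    rcases hpq.eq_or_lt with rfl | hlt
    · have := hconv p p le_rfl le_rfl le_rfl (hasAtMostZeros_Icc_self (by omega) p)
      exact ⟨p, le_rfl, le_rfl, this, this⟩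
    · refine ⟨(p + q) / 2, by linarith, by linarith, ?_, ?_⟩
      · exact hconv _ _ le_rfl (by linarith) (by linarith) (hgood.Icc_left hdim
          (fun w hw => (hcont w hw).mono (Set.Ico_subset_Icc_self.trans hsubset)) hone (by simp)
          (by linarith))
      · exact hconv _ _ (by linarith) (by linarith) le_rfl (hgood.Icc_right hdim
          (fun w hw => (hcont w hw).mono (Set.Ioc_subset_Icc_self.trans hsubset)) hone (by simp)
          (by linarith))
  obtain ⟨c, hc, h0, hl, hconvex⟩ := hsub2.exists_fin
  refine ⟨2 * k, c, ?_, by omega, hc, h0, hl, hconvex⟩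
  rcases Nat.eq_zero_or_pos k with rfl | hk0
  · exact absurd hsub hab.ne
  · omega
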